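/- Let $n\ge 2$ and let $(M^n,g)$ be a closed (compact, connected, without boundary) smooth Riemannian manifold of dimension $n$ with $\mathrm{Ric}\ge n-1$, i.e. $\mathrm{Ric}(v,v)\ge (n-1)\,g(v,v)$ for all tangent vectors $v$. Then for every $m\ge 2$ there exists a complete smooth Riemannian metric $G$ on $M\times\mathbb{R}^m$ with $\mathrm{Ric}\ge 0$ whose asymptotic cone is the cone $C(M,g)$. Here $C(M,g)$ is the quotient of $[0,\infty)\times M$ that collapses $\{0\}\times M$ to a point $o$, with the metric $$d\big((r,x),(s,y)\big)^2=r^2+s^2-2rs\cos\big(\min\{d_g(x,y),\pi\}\big),$$ where $d_g$ is the Riemannian distance of $g$; and the assertion on the asymptotic cone means that, for every base point $p\in M\times\mathbb{R}^m$, the pointed metric spaces $(M\times\mathbb{R}^m,\,R\,d_G,\,p)$ converge in the pointed Gromov--Hausdorff sense to $(C(M,g),o)$ as $R\to 0^+$. -/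

import Mathlib

open scoped Manifold ContDiff Topology

noncomputable section

/-! ### Curvature of a metric on a finite-dimensional vector space

`G y v w` is the value at `y` of a Riemannian metric on (an open subset of) the vector space `E`,
for instance a Riemannian metric read in a chart. -/

namespace LocalMetric

variable {E : Type*} [NormedAddCommGroup E] [NormedSpace ℝ E]

/-- Christoffel symbols of the first kind: the linear form
`w ↦ ½ (∂ᵤ G(v, w) + ∂ᵥ G(u, w) - ∂_w G(u, v))` at `y`. -/
def christoffelFirst (G : E → E →L[ℝ] E →L[ℝ] ℝ) (y u v : E) : E →L[ℝ] ℝ :=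
  (1 / 2 : ℝ) • (fderiv ℝ G y u v + fderiv ℝ G y v u - ((fderiv ℝ G y).flip u).flip v)

theorem christoffelFirst_apply (G : E → E →L[ℝ] E →L[ℝ] ℝ) (y u v w : E) :
    christoffelFirst G y u v w =
      1 / 2 * (fderiv ℝ G y u v w + fderiv ℝ G y v u w - fderiv ℝ G y w u v) := by
  simp [christoffelFirst]

variable [FiniteDimensional ℝ E]

/-- Christoffel symbols of the second kind: `Γ(u, v)` is the vector such that
`G(Γ(u, v), w)` is the Christoffel symbol of the first kind at `(u, v, w)`, for all `w`. Thus the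
Levi-Civita connection is `∇ᵤ V = ∂ᵤ V + Γ(u, V)`. -/
def christoffel (G : E → E →L[ℝ] E →L[ℝ] ℝ) (y : E) : E →L[ℝ] E →L[ℝ] E :=
  LinearMap.toContinuousBilinearMap <|
    LinearMap.mk₂ ℝ (fun u v ↦ ContinuousLinearMap.inverse (G y) (christoffelFirst G y u v))
      (fun a b v ↦ by
        rw [← map_add]; congr 1; ext w; simp [christoffelFirst_apply]; ring)
      (fun c a v ↦ by
        rw [← map_smul]; congr 1; ext w; simp [christoffelFirst_apply]; ring)
      (fun u a b ↦ by
        rw [← map_add]; congr 1; ext w; simp [christoffelFirst_apply]; ring)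
      (fun c u a ↦ by
        rw [← map_smul]; congr 1; ext w; simp [christoffelFirst_apply]; ring)

theorem christoffel_apply (G : E → E →L[ℝ] E →L[ℝ] ℝ) (y u v : E) :
    christoffel G y u v = ContinuousLinearMap.inverse (G y) (christoffelFirst G y u v) := rfl

/-- The linear map `u ↦ R(u, v) w` at `y`, where
`R(u, v) w = ∇ᵤ ∇ᵥ w - ∇ᵥ ∇ᵤ w` (for constant vector fields `u, v, w`) is the Riemann curvature
tensor. -/
def curvature (G : E → E →L[ℝ] E →L[ℝ] ℝ) (y v w : E) : E →ₗ[ℝ] E where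
  toFun u :=
    fderiv ℝ (christoffel G) y u v w - fderiv ℝ (christoffel G) y v u w
      + christoffel G y u (christoffel G y v w) - christoffel G y v (christoffel G y u w)
  map_add' a b := by
    simp only [map_add, add_apply]
    abel
  map_smul' c a := by
    simp only [map_smul, smul_apply, RingHom.id_apply, smul_sub, smul_add]

/-- The Ricci tensor `Ric(v, w)` at `y`: the trace of `u ↦ R(u, v) w`. -/
def ricci (G : E → E →L[ℝ] E →L[ℝ] ℝ) (y v w : E) : ℝ :=
  LinearMap.trace ℝ E (curvature G y v w)

end LocalMetric

/-! ### Riemannian metrics on manifolds without boundary -/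

/-- Smooth Riemannian metrics on the smooth manifold `M`. -/
abbrev SmoothMetric {E : Type*} [NormedAddCommGroup E] [NormedSpace ℝ E]
    {H : Type*} [TopologicalSpace H] (I : ModelWithCorners ℝ E H)
    (M : Type*) [TopologicalSpace M] [ChartedSpace H M] [IsManifold I ∞ M] :=
  Bundle.ContMDiffRiemannianMetric I ∞ E (fun x : M ↦ TangentSpace I x)

namespace SmoothMetric

open scoped Bundle

variable {E : Type*} [NormedAddCommGroup E] [NormedSpace ℝ E] [FiniteDimensional ℝ E]
  {H : Type*} [TopologicalSpace H] {I : ModelWithCorners ℝ E H}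
  {M : Type*} [TopologicalSpace M] [ChartedSpace H M] [IsManifold I ∞ M]

/-- The metric read in the preferred chart `φ` at `x`, that is the pullback of the metric under
`φ⁻¹`: at the point `y` of the target of `φ` its value on `v, w` is
`g (dφ⁻¹ v, dφ⁻¹ w)`, at the point `φ⁻¹ y`. -/
def inChart (g : SmoothMetric I M) (x : M) (y : E) : E →L[ℝ] E →L[ℝ] ℝ :=
  let A : E →L[ℝ] TangentSpace I ((extChartAt I x).symm y) :=
    mfderiv 𝓘(ℝ, E) I (extChartAt I x).symm y
  (ContinuousLinearMap.precomp ℝ A) ∘L (g.inner ((extChartAt I x).symm y)) ∘L A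

/-- The Ricci tensor of a Riemannian metric (on a manifold without boundary), as a function of two
tangent vectors at `x`; it is computed in the preferred chart at `x`. -/
def ricci (g : SmoothMetric I M) (x : M) (v w : TangentSpace I x) : ℝ :=
  LocalMetric.ricci (g.inChart x) (extChartAt I x x)
    (mfderiv I 𝓘(ℝ, E) (extChartAt I x) x v) (mfderiv I 𝓘(ℝ, E) (extChartAt I x) x w)

/-- `Ric ≥ k`, i.e. `Ric(v, v) ≥ k g(v, v)` for all tangent vectors `v`. -/
def RicciGE (g : SmoothMetric I M) (k : ℝ) : Prop :=
  ∀ (x : M) (v : TangentSpace I x), k * g.inner x v v ≤ g.ricci x v v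

/-- The Riemannian distance: the infimum of the lengths of `C^1` curves between two points.
(It is finite on connected manifolds.) -/
def dist (g : SmoothMetric I M) (x y : M) : ℝ :=
  letI : Bundle.RiemannianBundle (fun x : M ↦ TangentSpace I x) := ⟨g.toRiemannianMetric⟩
  (Manifold.riemannianEDist I x y).toReal

/-- A Riemannian metric is complete if the manifold is complete for the Riemannian distance. -/
def IsComplete [T3Space M] (g : SmoothMetric I M) : Prop :=
  letI : Bundle.RiemannianBundle (fun x : M ↦ TangentSpace I x) := ⟨g.toRiemannianMetric⟩
  haveI : IsContinuousRiemannianBundle E (fun x : M ↦ TangentSpace I x) :=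
    ⟨g.inner, g.contMDiff.continuous, fun _ _ _ ↦ rfl⟩
  letI : EMetricSpace M := EMetricSpace.ofRiemannianMetric I M
  CompleteSpace M

end SmoothMetric

/-! ### Metric cones -/

namespace MetricCone

open scoped NNReal

/-- Two pairs `(r, x)`, `(s, y)` define the same point of the cone if they are equal or if
`r = s = 0`. -/
def setoid (X : Type*) : Setoid (ℝ≥0 × X) where
  r a b := a = b ∨ (a.1 = 0 ∧ b.1 = 0)
  iseqv :=
    { refl := fun _ ↦ Or.inl rfl
      symm := by
        rintro a b (rfl | h)
        · exact Or.inl rfl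
        · exact Or.inr ⟨h.2, h.1⟩
      trans := by
        rintro a b c (rfl | h) (rfl | h')
        · exact Or.inl rfl
        · exact Or.inr h'
        · exact Or.inr h
        · exact Or.inr ⟨h.1, h'.2⟩ }

end MetricCone

/-- The cone over `X`: the quotient of `[0, ∞) × X` that collapses `{0} × X` to a point. -/
def MetricCone (X : Type*) : Type _ := Quotient (MetricCone.setoid X)

namespace MetricCone

open scoped NNReal

/-- The point of the cone given by `(r, x)`. -/
def mk {X : Type*} (r : ℝ≥0) (x : X) : MetricCone X := Quotient.mk (setoid X) (r, x)

/-- The apex of the cone. -/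
def apex (X : Type*) [Nonempty X] : MetricCone X := mk 0 (Classical.arbitrary X)

/-- The cone distance on pairs: `√(r² + s² - 2 r s cos (min (d(x, y), π)))`. -/
def preDist {X : Type*} (d : X → X → ℝ) (a b : ℝ≥0 × X) : ℝ :=
  √((a.1 : ℝ) ^ 2 + (b.1 : ℝ) ^ 2 - 2 * a.1 * b.1 * Real.cos (min (d a.2 b.2) Real.pi))

/-- The Euclidean cone distance on the cone over a space `X` with distance function `d`. -/
def dist {X : Type*} (d : X → X → ℝ) : MetricCone X → MetricCone X → ℝ :=
  Quotient.lift₂ (s₁ := setoid X) (s₂ := setoid X) (preDist d) (by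
    rintro a b a' b' (rfl | h) (rfl | h')
    · rfl
    · simp [preDist, h'.1, h'.2]
    · simp [preDist, h.1, h.2]
    · simp [preDist, h.1, h.2, h'.1, h'.2])

end MetricCone

/-! ### Pointed Gromov-Hausdorff convergence and asymptotic cones -/

/-- Pointed Gromov-Hausdorff convergence, along the filter `l`, of a family of pointed metric
spaces `(X i, d i, p i)` to the pointed length space `(Y, dY, q)`: for all `r, ε > 0`, eventually
there is a map `f` from the ball `B_r(p i)` to `Y` with `f (p i) = q`, of distortion less than `ε`,
such that the `ε`-neighbourhood of `f (B_r(p i))` contains `B_{r - ε}(q)`. (The values of `f`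
outside `B_r(p i)` play no role.) -/
def PointedGHTendsto {ι : Type*} (l : Filter ι) {X : ι → Type*} (d : ∀ i, X i → X i → ℝ)
    (p : ∀ i, X i) {Y : Type*} (dY : Y → Y → ℝ) (q : Y) : Prop :=
  ∀ r > 0, ∀ ε > 0, ∀ᶠ i in l, ∃ f : X i → Y,
    f (p i) = q ∧
    (∃ δ < ε, ∀ a b, d i (p i) a < r → d i (p i) b < r → |dY (f a) (f b) - d i a b| ≤ δ) ∧
    ∀ y, dY q y < r - ε → ∃ a, d i (p i) a < r ∧ dY y (f a) < ε

/-- The space `N` with distance function `d` has asymptotic cone `(Y, dY, q)`: for every base point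
`p`, the rescaled pointed spaces `(N, R d, p)` converge to `(Y, dY, q)` as `R → 0`. -/
def HasAsymptoticCone {N : Type*} (d : N → N → ℝ) {Y : Type*} (dY : Y → Y → ℝ) (q : Y) : Prop :=
  ∀ p : N, PointedGHTendsto (𝓝[>] (0 : ℝ)) (X := fun _ ↦ N) (fun R a b ↦ R * d a b) (fun _ ↦ p)
    dY q

end

set_option maxSynthPendingDepth 3

noncomputable section

namespace LocalMetric

variable {E : Type*} [NormedAddCommGroup E] [NormedSpace ℝ E] [FiniteDimensional ℝ E]

theorem isInvertible_of_pos {B : E →L[ℝ] E →L[ℝ] ℝ} (hB : ∀ v, v ≠ 0 → 0 < B v v) :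
    B.IsInvertible := by
  have hfin : Module.finrank ℝ E = Module.finrank ℝ (E →L[ℝ] ℝ) := by
    rw [← (LinearMap.toContinuousLinearMap (𝕜 := ℝ) (E := E) (F' := ℝ)).finrank_eq]
    exact (Subspace.dual_finrank_eq (K := ℝ) (V := E)).symm
  have hinj : Function.Injective (B : E →ₗ[ℝ] E →L[ℝ] ℝ) := by
    refine (injective_iff_map_eq_zero _).2 fun v hv ↦ ?_
    by_contra hne
    have h0 : B v v = 0 := by
      have : B v = 0 := hv
      rw [this]; rfl
    exact (hB v hne).ne' h0
  exact ⟨(LinearEquiv.ofInjectiveOfFinrankEq _ hinj hfin).toContinuousLinearEquiv, by ext; rfl⟩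

/-- `G` is a smooth Riemannian metric on the open subset `U` of the vector space `E`. -/
structure IsMetricOn (G : E → E →L[ℝ] E →L[ℝ] ℝ) (U : Set E) : Prop where
  isOpen : IsOpen U
  contDiffOn : ContDiffOn ℝ ∞ G U
  symm : ∀ y ∈ U, ∀ v w, G y v w = G y w v
  pos : ∀ y ∈ U, ∀ v, v ≠ 0 → 0 < G y v v

theorem differentiableAt_of_forall_apply {D F : Type*} [NormedAddCommGroup D] [NormedSpace ℝ D]
    [NormedAddCommGroup F] [NormedSpace ℝ F] {f : D → E →L[ℝ] F} {x : D}
    (h : ∀ v, DifferentiableAt ℝ (fun y ↦ f y v) x) : DifferentiableAt ℝ f x := by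
  let d := Module.finrank ℝ E
  have hd : d = Module.finrank ℝ (Fin d → ℝ) := (Module.finrank_fin_fun ℝ).symm
  let e₁ := ContinuousLinearEquiv.ofFinrankEq hd
  let e₂ := (e₁.arrowCongr (1 : F ≃L[ℝ] F)).trans (ContinuousLinearEquiv.piRing (Fin d))
  rw [← Function.id_comp f, ← e₂.symm_comp_self]
  exact e₂.symm.differentiableAt.comp x (differentiableAt_pi.2 fun i ↦ h _)

omit [FiniteDimensional ℝ E] in
theorem fderiv_apply_apply {D F E' : Type*} [NormedAddCommGroup D] [NormedSpace ℝ D]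
    [NormedAddCommGroup E'] [NormedSpace ℝ E']
    [NormedAddCommGroup F] [NormedSpace ℝ F] {f : D → E →L[ℝ] E' →L[ℝ] F} {x : D}
    (h : DifferentiableAt ℝ f x) (u : D) (v : E) (w : E') :
    fderiv ℝ f x u v w = fderiv ℝ (fun y ↦ f y v w) x u := by
  have h1 := (h.hasFDerivAt.clm_apply (hasFDerivAt_const v x)).clm_apply (hasFDerivAt_const w x)
  rw [h1.fderiv]
  simp

variable {G : E → E →L[ℝ] E →L[ℝ] ℝ} {U : Set E} {y : E}

theorem christoffel_eq_of_forall (hG : ∀ v, v ≠ 0 → 0 < G y v v) {u v z : E}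
    (h : ∀ w, G y z w = christoffelFirst G y u v w) : christoffel G y u v = z := by
  rw [christoffel_apply, (isInvertible_of_pos hG).inverse_apply_eq]
  ext w
  exact (h w).symm

namespace IsMetricOn

theorem apply_christoffel (hG : IsMetricOn G U) (hy : y ∈ U) (u v w : E) :
    G y (christoffel G y u v) w = christoffelFirst G y u v w := by
  rw [christoffel_apply, (isInvertible_of_pos (hG.pos y hy)).self_apply_inverse]

omit [FiniteDimensional ℝ E] in
theorem differentiableAt (hG : IsMetricOn G U) (hy : y ∈ U) : DifferentiableAt ℝ G y :=
  (hG.contDiffOn.contDiffAt (hG.isOpen.mem_nhds hy)).differentiableAt (by simp)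

theorem differentiableAt_christoffel (hG : IsMetricOn G U) (hy : y ∈ U) :
    DifferentiableAt ℝ (christoffel G) y := by
  refine differentiableAt_of_forall_apply fun u ↦ differentiableAt_of_forall_apply fun v ↦ ?_
  have hd := hG.contDiffOn.contDiffAt (hG.isOpen.mem_nhds hy)
  have hf := (hd.fderiv_right (m := 1) (by
    rw [one_add_one_eq_two]; exact WithTop.coe_le_coe.2 le_top)).differentiableAt one_ne_zero
  obtain ⟨e, he⟩ := isInvertible_of_pos (hG.pos y hy)
  have hinv : DifferentiableAt ℝ (fun z ↦ ContinuousLinearMap.inverse (G z)) y := by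
    have h1 : ContDiffAt ℝ 1 ContinuousLinearMap.inverse (G y) := by
      rw [← he]; exact contDiffAt_map_inverse e
    exact (h1.differentiableAt (by simp)).comp y (hG.differentiableAt hy)
  have hfirst : DifferentiableAt ℝ (fun z ↦ christoffelFirst G z u v) y := by
    refine differentiableAt_of_forall_apply fun w ↦ ?_
    have hf3 (a b c : E) : DifferentiableAt ℝ (fun z ↦ fderiv ℝ G z a b c) y :=
      ((hf.clm_apply (differentiableAt_const a)).clm_apply (differentiableAt_const b)).clm_apply
        (differentiableAt_const c)
    simp only [christoffelFirst_apply]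
    exact (((hf3 u v w).add (hf3 v u w)).sub (hf3 w u v)).const_mul _
  exact hinv.clm_apply hfirst

theorem christoffel_comm (hG : IsMetricOn G U) (hy : y ∈ U) (u v : E) :
    christoffel G y u v = christoffel G y v u := by
  refine christoffel_eq_of_forall (hG.pos y hy) fun w ↦ ?_
  rw [hG.apply_christoffel hy, christoffelFirst_apply, christoffelFirst_apply]
  have : fderiv ℝ G y w u v = fderiv ℝ G y w v u := by
    rw [fderiv_apply_apply (hG.differentiableAt hy), fderiv_apply_apply (hG.differentiableAt hy)]
    congr 1
    refine Filter.EventuallyEq.fderiv_eq ?_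
    filter_upwards [hG.isOpen.mem_nhds hy] with z hz using hG.symm z hz u v
  rw [this]; ring

end IsMetricOn

theorem curvature_congr {G' : E → E →L[ℝ] E →L[ℝ] ℝ} (h : G =ᶠ[𝓝 y] G') (v w : E) :
    curvature G y v w = curvature G' y v w := by
  have hΓ : christoffel G =ᶠ[𝓝 y] christoffel G' := by
    filter_upwards [h.eventuallyEq_nhds] with z hz
    ext u v
    have : christoffelFirst G z u v = christoffelFirst G' z u v := by
      ext w
      simp only [christoffelFirst_apply, hz.fderiv_eq]
    rw [christoffel_apply, christoffel_apply, this, hz.eq_of_nhds]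
  ext u
  simp only [curvature, LinearMap.coe_mk, AddHom.coe_mk, hΓ.fderiv_eq, hΓ.eq_of_nhds]

theorem ricci_congr {G' : E → E →L[ℝ] E →L[ℝ] ℝ} (h : G =ᶠ[𝓝 y] G') (v w : E) :
    ricci G y v w = ricci G' y v w := by
  rw [ricci, ricci, curvature_congr h]

end LocalMetric

theorem LinearMap.trace_prod {E F : Type*} [AddCommGroup E] [Module ℝ E] [FiniteDimensional ℝ E]
    [AddCommGroup F] [Module ℝ F] [FiniteDimensional ℝ F] (f : E × F →ₗ[ℝ] E × F) :
    LinearMap.trace ℝ (E × F) f =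
      LinearMap.trace ℝ E (LinearMap.fst ℝ E F ∘ₗ f ∘ₗ LinearMap.inl ℝ E F) +
      LinearMap.trace ℝ F (LinearMap.snd ℝ E F ∘ₗ f ∘ₗ LinearMap.inr ℝ E F) := by
  rw [LinearMap.trace_comp_comm' (f ∘ₗ LinearMap.inl ℝ E F),
    LinearMap.trace_comp_comm' (f ∘ₗ LinearMap.inr ℝ E F), ← map_add]
  congr 1
  refine LinearMap.ext fun v ↦ ?_
  simp [← map_add]


namespace WarpedCone

/-! ### Radial profile functions -/

/-- The smooth function `w ↦ ((1 + w) ^ a - 1) / w`. -/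
def quot (a w : ℝ) : ℝ := dslope (fun s : ℝ ↦ (1 + s) ^ a) 0 w

variable {a w : ℝ}

theorem hasDerivAt_one_add_rpow (hw : 0 < 1 + w) :
    HasDerivAt (fun w : ℝ ↦ (1 + w) ^ a) (a * (1 + w) ^ a / (1 + w)) w := by
  have h := ((hasDerivAt_id w).const_add 1).rpow_const (p := a) (Or.inl hw.ne')
  convert! h using 1
  simp only [id]
  rw [Real.rpow_sub_one hw.ne']
  ring

theorem contDiffAt_one_add_rpow (hw : 0 < 1 + w) {k : WithTop ℕ∞} :
    ContDiffAt ℝ k (fun w : ℝ ↦ (1 + w) ^ a) w :=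
  (contDiffAt_const.add contDiffAt_id).rpow_const_of_ne hw.ne'

theorem mul_quot (a w : ℝ) : w * quot a w = (1 + w) ^ a - 1 := by
  have := sub_smul_dslope (fun s : ℝ ↦ (1 + s) ^ a) 0 w
  simpa [quot] using this

theorem quot_nonneg (ha : 0 ≤ a) (hw : 0 ≤ w) : 0 ≤ quot a w := by
  rcases hw.eq_or_lt with rfl | hw
  · rw [quot, dslope_same, (hasDerivAt_one_add_rpow (by norm_num)).deriv]
    simpa using ha
  · have h := mul_quot a w
    have h1 : 1 ≤ (1 + w) ^ a := Real.one_le_rpow (by linarith) ha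
    by_contra hneg
    nlinarith [mul_neg_of_pos_of_neg hw (not_le.1 hneg)]

theorem contDiffAt_quot (hw : 0 < 1 + w) : ContDiffAt ℝ ∞ (quot a) w := by
  by_cases h : w = 0
  · rw [h]
    exact Real.one_add_rpow_hasFPowerSeriesAt_zero.has_fpower_series_dslope_fslope.analyticAt.contDiffAt
  · refine ContDiffAt.congr_of_eventuallyEq (f := fun s : ℝ ↦ (s - 0)⁻¹ • ((1 + s) ^ a - (1 + 0) ^ a))
      ?_ ?_
    · exact ((contDiffAt_id.sub contDiffAt_const).inv (sub_ne_zero.2 h)).smul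
        ((contDiffAt_one_add_rpow hw).sub contDiffAt_const)
    · exact dslope_eventuallyEq_slope_of_ne _ h

theorem hasDerivAt_quot (hw : 0 < 1 + w) : HasDerivAt (quot a) (deriv (quot a) w) w :=
  ((contDiffAt_quot hw).differentiableAt (by simp)).hasDerivAt

theorem quot_add_mul_deriv (hw : 0 < 1 + w) :
    quot a w + w * deriv (quot a) w = a * (1 + w) ^ a / (1 + w) := by
  have h1 := (hasDerivAt_id w).mul (hasDerivAt_quot (a := a) hw)
  have h2 : HasDerivAt (fun w ↦ w * quot a w) (a * (1 + w) ^ a / (1 + w)) w := by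
    simp only [mul_quot]
    exact (hasDerivAt_one_add_rpow hw).sub_const 1
  simpa using h1.unique h2

/-- The first of the two functions in the Christoffel symbols of the cap metric. -/
def capQ (a w : ℝ) : ℝ := (quot a w + (1 + w)⁻¹) / (1 + w) ^ a

/-- The second of the two functions in the Christoffel symbols of the cap metric. -/
def capL (a w : ℝ) : ℝ := (deriv (quot a) w + quot a w / (1 + w)) / (1 + w) ^ a

theorem differentiableAt_capQ (hw : 0 < 1 + w) : DifferentiableAt ℝ (capQ a) w := by
  have h1 := (hasDerivAt_quot (a := a) hw).differentiableAt
  have h2 := (hasDerivAt_one_add_rpow (a := a) hw).differentiableAt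
  have h3 : DifferentiableAt ℝ (fun w : ℝ ↦ (1 + w)⁻¹) w :=
    (differentiableAt_id.const_add 1).inv hw.ne'
  exact (h1.add h3).div h2 (Real.rpow_pos_of_pos hw a).ne'

theorem differentiableAt_capL (hw : 0 < 1 + w) : DifferentiableAt ℝ (capL a) w := by
  have h1 := (hasDerivAt_quot (a := a) hw).differentiableAt
  have h2 := (hasDerivAt_one_add_rpow (a := a) hw).differentiableAt
  have h3 : DifferentiableAt ℝ (deriv (quot a)) w := by
    have := (contDiffAt_quot (a := a) hw).fderiv_right (m := 1) (by
      rw [one_add_one_eq_two]; exact WithTop.coe_le_coe.2 le_top)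
    exact (this.differentiableAt one_ne_zero).clm_apply (differentiableAt_const 1)
  exact (h3.add (h1.div (differentiableAt_id.const_add 1) hw.ne')).div h2
    (Real.rpow_pos_of_pos hw a).ne'

theorem capQ_nonneg (ha : 0 ≤ a) (hw : 0 ≤ w) : 0 ≤ capQ a w := by
  have := quot_nonneg ha hw
  unfold capQ
  positivity

theorem mul_capQ (hw : 0 < 1 + w) : w * capQ a w = 1 - 1 / ((1 + w) * (1 + w) ^ a) := by
  have h := mul_quot a w
  have hX := (Real.rpow_pos_of_pos hw a).ne'
  unfold capQ
  field_simp
  linear_combination (1 + w) * h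

theorem capQ_add_mul_capL (hw : 0 < 1 + w) : capQ a w + w * capL a w = (a + 1) / (1 + w) := by
  have h := mul_quot a w
  have h' := quot_add_mul_deriv (a := a) hw
  have hX := (Real.rpow_pos_of_pos hw a).ne'
  unfold capQ capL
  field_simp
  field_simp at h'
  linear_combination h + h'

theorem capQ_add_mul_deriv (hw : 0 < 1 + w) :
    capQ a w + w * deriv (capQ a) w = (a + 1) / ((1 + w) ^ 2 * (1 + w) ^ a) := by
  have hX := (Real.rpow_pos_of_pos hw a).ne'
  have h1 := (hasDerivAt_id w).mul (differentiableAt_capQ (a := a) hw).hasDerivAt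
  have h2 : HasDerivAt (fun w : ℝ ↦ 1 - 1 / ((1 + w) * (1 + w) ^ a))
      ((a + 1) / ((1 + w) ^ 2 * (1 + w) ^ a)) w := by
    have := (((hasDerivAt_const w (1 : ℝ)).div (((hasDerivAt_id w).const_add 1).mul
      (hasDerivAt_one_add_rpow (a := a) hw)) (mul_ne_zero hw.ne' hX)).const_sub 1)
    convert! this using 1
    simp only [id, Pi.mul_apply]
    field_simp
    ring
  have h3 : (fun w ↦ w * capQ a w) =ᶠ[𝓝 w] fun w : ℝ ↦ 1 - 1 / ((1 + w) * (1 + w) ^ a) := by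
    filter_upwards [(isOpen_lt continuous_const (continuous_const.add continuous_id)).mem_nhds hw]
      with z hz using mul_capQ hz
  simpa using h1.unique (h2.congr_of_eventuallyEq h3)

theorem one_add_norm_sq_pos {F : Type*} [NormedAddCommGroup F] (y : F) : 0 < 1 + ‖y‖ ^ 2 := by
  positivity

/-! ### The metric on the second factor and the warped metric -/

variable {F : Type*} [NormedAddCommGroup F] [InnerProductSpace ℝ F]

variable (F) in
/-- The inner product of a real inner product space as a continuous bilinear form. -/
def innerForm : F →L[ℝ] F →L[ℝ] ℝ := innerSL ℝ

theorem innerForm_apply (u v : F) : innerForm F u v = inner ℝ u v := rfl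

/-- The rotationally symmetric metric `a² / (1 + |y|²) * (⟨u, v⟩ + quot ⟨y, u⟩ ⟨y, v⟩)`. -/
def capMetric (a : ℝ) (y : F) : F →L[ℝ] F →L[ℝ] ℝ :=
  (a ^ 2 / (1 + ‖y‖ ^ 2)) •
    (innerForm F + quot a (‖y‖ ^ 2) • (innerForm F y).smulRight (innerForm F y))

theorem capMetric_apply (a : ℝ) (y u v : F) :
    capMetric a y u v = a ^ 2 / (1 + ‖y‖ ^ 2) *
      (inner ℝ u v + quot a (‖y‖ ^ 2) * (inner ℝ y u * inner ℝ y v)) := by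
  simp [capMetric, innerForm_apply]
  ring

theorem capMetric_symm (a : ℝ) (y u v : F) : capMetric a y u v = capMetric a y v u := by
  rw [capMetric_apply, capMetric_apply, real_inner_comm u v]; ring

theorem le_capMetric (ha : 0 ≤ a) (y v : F) :
    a ^ 2 / (1 + ‖y‖ ^ 2) * ‖v‖ ^ 2 ≤ capMetric a y v v := by
  rw [capMetric_apply, real_inner_self_eq_norm_sq]
  have := mul_nonneg (quot_nonneg ha (sq_nonneg ‖y‖)) (mul_self_nonneg (inner ℝ y v))
  gcongr
  linarith

theorem capMetric_pos (ha : 0 < a) (y : F) {v : F} (hv : v ≠ 0) : 0 < capMetric a y v v := by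
  refine lt_of_lt_of_le ?_ (le_capMetric ha.le y v)
  have := norm_pos_iff.2 hv
  positivity

theorem contDiff_capMetric (a : ℝ) : ContDiff ℝ ∞ (capMetric a : F → F →L[ℝ] F →L[ℝ] ℝ) := by
  have hn : ContDiff ℝ ∞ (fun y : F ↦ ‖y‖ ^ 2) := contDiff_norm_sq ℝ
  have h1 : ContDiff ℝ ∞ (fun y : F ↦ a ^ 2 / (1 + ‖y‖ ^ 2)) :=
    contDiff_const.div (contDiff_const.add hn) fun y ↦ (one_add_norm_sq_pos y).ne'
  have h2 : ContDiff ℝ ∞ (fun y : F ↦ quot a (‖y‖ ^ 2)) := by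
    rw [contDiff_iff_contDiffAt]
    intro y
    exact ContDiffAt.comp (g := quot a) y (contDiffAt_quot (one_add_norm_sq_pos y)) hn.contDiffAt
  have h3 : ContDiff ℝ ∞ (innerForm F) := (innerForm F).contDiff
  exact h1.smul (contDiff_const.add (h2.smul (h3.smulRight h3)))

variable {E : Type*} [NormedAddCommGroup E] [NormedSpace ℝ E]

/-- The warped product `(1 + |y|²) ^ a g + capMetric` at a point `p = (x, y)`, for a bilinear form
`g` at `x`. -/
def warpAt (a : ℝ) (g : E →L[ℝ] E →L[ℝ] ℝ) (y : F) : (E × F) →L[ℝ] (E × F) →L[ℝ] ℝ :=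
  ((1 + ‖y‖ ^ 2) ^ a) • ((ContinuousLinearMap.precomp ℝ (.fst ℝ E F)) ∘L g ∘L (.fst ℝ E F)) +
    (ContinuousLinearMap.precomp ℝ (.snd ℝ E F)) ∘L (capMetric a y) ∘L (.snd ℝ E F)

theorem warpAt_apply (a : ℝ) (g : E →L[ℝ] E →L[ℝ] ℝ) (y : F) (u v : E × F) :
    warpAt a g y u v = (1 + ‖y‖ ^ 2) ^ a * g u.1 v.1 + capMetric a y u.2 v.2 := by
  simp [warpAt]

theorem warpAt_pos (ha : 0 < a) {g : E →L[ℝ] E →L[ℝ] ℝ} (hg : ∀ v, v ≠ 0 → 0 < g v v) (y : F)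
    {v : E × F} (hv : v ≠ 0) : 0 < warpAt a g y v v := by
  rw [warpAt_apply]
  have hX := Real.rpow_pos_of_pos (one_add_norm_sq_pos y) a
  by_cases h1 : v.1 = 0
  · have h2 : v.2 ≠ 0 := fun h2 ↦ hv (Prod.ext h1 h2)
    have := capMetric_pos ha y h2
    rw [h1]; simpa using this
  · have := mul_pos hX (hg _ h1)
    have h3 : 0 ≤ capMetric a y v.2 v.2 := le_trans (by positivity) (le_capMetric ha.le y v.2)
    linarith

theorem contDiffOn_warpAt {D : Type*} [NormedAddCommGroup D] [NormedSpace ℝ D] (a : ℝ) {s : Set D}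
    {g : D → E →L[ℝ] E →L[ℝ] ℝ} {Y : D → F} (hg : ContDiffOn ℝ ∞ g s) (hY : ContDiffOn ℝ ∞ Y s) :
    ContDiffOn ℝ ∞ (fun p ↦ warpAt a (g p) (Y p)) s := by
  have h1 : ContDiffOn ℝ ∞ (fun p ↦ (1 + ‖Y p‖ ^ 2) ^ a) s :=
    (contDiffOn_const.add (hY.norm_sq ℝ)).rpow_const_of_ne fun p _ ↦ (one_add_norm_sq_pos _).ne'
  have h2 : ContDiffOn ℝ ∞ (fun p ↦ capMetric a (Y p)) s := (contDiff_capMetric a).comp_contDiffOn hY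
  refine (h1.smul ?_).add ?_
  · exact contDiffOn_const.clm_comp (hg.clm_comp contDiffOn_const)
  · exact contDiffOn_const.clm_comp (h2.clm_comp contDiffOn_const)

theorem isMetricOn_warpAt (ha : 0 < a) {g : E → E →L[ℝ] E →L[ℝ] ℝ} {U : Set E}
    (hg : LocalMetric.IsMetricOn g U) :
    LocalMetric.IsMetricOn (fun p : E × F ↦ warpAt a (g p.1) p.2) (U ×ˢ Set.univ) where
  isOpen := hg.isOpen.prod isOpen_univ
  contDiffOn := contDiffOn_warpAt a
    (hg.contDiffOn.comp contDiff_fst.contDiffOn fun p hp ↦ hp.1) contDiff_snd.contDiffOn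
  symm p hp v w := by
    rw [warpAt_apply, warpAt_apply, hg.symm _ hp.1, capMetric_symm]
  pos p hp v hv := warpAt_pos ha (hg.pos _ hp.1) _ hv

end WarpedCone


namespace WarpedCone

/-! ### Christoffel symbols of the warped metric -/

theorem fderiv_eq_of_hasDerivAt_line {D F' : Type*} [NormedAddCommGroup D] [NormedSpace ℝ D]
    [NormedAddCommGroup F'] [NormedSpace ℝ F'] {f : D → F'} {p u : D} {d : F'}
    (hf : DifferentiableAt ℝ f p) (h : HasDerivAt (fun t : ℝ ↦ f (p + t • u)) d 0) :
    fderiv ℝ f p u = d :=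
  (hf.hasFDerivAt.hasLineDerivAt u).unique h

variable {F : Type*} [NormedAddCommGroup F] [InnerProductSpace ℝ F]

theorem hasDerivAt_line {D : Type*} [NormedAddCommGroup D] [NormedSpace ℝ D] (y u : D) :
    HasDerivAt (fun t : ℝ ↦ y + t • u) u 0 := by
  simpa using ((hasDerivAt_id (0 : ℝ)).smul_const u).const_add y

theorem hasDerivAt_inner_line (y u v : F) :
    HasDerivAt (fun t : ℝ ↦ (inner ℝ (y + t • u) v : ℝ)) (inner ℝ u v) 0 := by
  simpa using (hasDerivAt_line y u).inner ℝ (hasDerivAt_const 0 v)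

theorem hasDerivAt_radial_line {φ : ℝ → ℝ} {φ' : ℝ} {y : F} (h : HasDerivAt φ φ' (‖y‖ ^ 2)) (u : F) :
    HasDerivAt (fun t : ℝ ↦ φ (‖y + t • u‖ ^ 2)) (φ' * (2 * inner ℝ y u)) 0 := by
  have h1 := (hasDerivAt_line y u).norm_sq
  have h2 : HasDerivAt φ φ' (‖y + (0 : ℝ) • u‖ ^ 2) := by simpa using h
  have h3 := HasDerivAt.comp (0 : ℝ) h2 h1
  simp only [zero_smul, add_zero] at h3
  exact h3

theorem hasDerivAt_div_one_add (c : ℝ) {w : ℝ} (hw : 0 < 1 + w) :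
    HasDerivAt (fun w : ℝ ↦ c / (1 + w)) (-(c / (1 + w) ^ 2)) w := by
  have := (hasDerivAt_const w c).div ((hasDerivAt_id w).const_add 1) hw.ne'
  convert! this using 1
  simp only [id]
  field_simp
  ring

theorem fderiv_capMetric (a : ℝ) (y u v z : F) :
    fderiv ℝ (capMetric a) y u v z =
      -(a ^ 2 / (1 + ‖y‖ ^ 2) ^ 2) * (2 * inner ℝ y u) *
        (inner ℝ v z + quot a (‖y‖ ^ 2) * (inner ℝ y v * inner ℝ y z)) +
      a ^ 2 / (1 + ‖y‖ ^ 2) *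
        (deriv (quot a) (‖y‖ ^ 2) * (2 * inner ℝ y u) * (inner ℝ y v * inner ℝ y z) +
          quot a (‖y‖ ^ 2) * (inner ℝ u v * inner ℝ y z + inner ℝ y v * inner ℝ u z)) := by
  have hd : DifferentiableAt ℝ (capMetric a : F → F →L[ℝ] F →L[ℝ] ℝ) y :=
    (contDiff_capMetric a).contDiffAt.differentiableAt (by simp)
  rw [LocalMetric.fderiv_apply_apply hd]
  refine fderiv_eq_of_hasDerivAt_line
    ((hd.clm_apply (differentiableAt_const v)).clm_apply (differentiableAt_const z)) ?_
  simp only [capMetric_apply]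
  have hw := one_add_norm_sq_pos y
  have h1 := hasDerivAt_radial_line (hasDerivAt_div_one_add (a ^ 2) hw) u
  have h2 := hasDerivAt_radial_line (hasDerivAt_quot (a := a) hw) u
  have h3 := (hasDerivAt_inner_line y u v).mul (hasDerivAt_inner_line y u z)
  convert! h1.mul ((h2.mul h3).const_add (inner ℝ v z)) using 1
  simp

variable {E : Type*} [NormedAddCommGroup E] [NormedSpace ℝ E]
  {g : E → E →L[ℝ] E →L[ℝ] ℝ} {U : Set E} {a : ℝ}

section

variable [FiniteDimensional ℝ E] [FiniteDimensional ℝ F]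

omit [FiniteDimensional ℝ E] [FiniteDimensional ℝ F] in
theorem fderiv_warpAt (ha : 0 < a) (hg : LocalMetric.IsMetricOn g U) {p : E × F} (hp : p.1 ∈ U)
    (u v z : E × F) :
    fderiv ℝ (fun p : E × F ↦ warpAt a (g p.1) p.2) p u v z =
      a * (1 + ‖p.2‖ ^ 2) ^ a / (1 + ‖p.2‖ ^ 2) * (2 * inner ℝ p.2 u.2) * g p.1 v.1 z.1 +
      (1 + ‖p.2‖ ^ 2) ^ a * fderiv ℝ g p.1 u.1 v.1 z.1 +
      fderiv ℝ (capMetric a) p.2 u.2 v.2 z.2 := by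
  have hd := (isMetricOn_warpAt (F := F) ha hg).differentiableAt (y := p) ⟨hp, trivial⟩
  have hcap : DifferentiableAt ℝ (capMetric a : F → F →L[ℝ] F →L[ℝ] ℝ) p.2 :=
    (contDiff_capMetric a).contDiffAt.differentiableAt (by simp)
  rw [LocalMetric.fderiv_apply_apply hd]
  refine fderiv_eq_of_hasDerivAt_line
    ((hd.clm_apply (differentiableAt_const v)).clm_apply (differentiableAt_const z)) ?_
  simp only [warpAt_apply, Prod.fst_add, Prod.snd_add, Prod.smul_fst, Prod.smul_snd]
  have h1 := hasDerivAt_radial_line (hasDerivAt_one_add_rpow (a := a) (one_add_norm_sq_pos p.2)) u.2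
  have hgd := hg.differentiableAt hp
  have h2 := (((hgd.clm_apply (differentiableAt_const v.1)).clm_apply
    (differentiableAt_const z.1)).hasFDerivAt.hasLineDerivAt u.1)
  have h3 := (((hcap.clm_apply (differentiableAt_const v.2)).clm_apply
    (differentiableAt_const z.2)).hasFDerivAt.hasLineDerivAt u.2)
  rw [← LocalMetric.fderiv_apply_apply hgd] at h2
  rw [← LocalMetric.fderiv_apply_apply hcap] at h3
  have h2' : HasDerivAt (fun t : ℝ ↦ g (p.1 + t • u.1) v.1 z.1) _ 0 := h2
  have h3' : HasDerivAt (fun t : ℝ ↦ capMetric a (p.2 + t • u.2) v.2 z.2) _ 0 := h3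
  have := (h1.mul h2').add h3'
  convert! this using 1
  simp

end

/-- The Christoffel symbols of the warped metric at `(x, y)`, in terms of the value `b` at `x` of
the metric on the first factor and of its Christoffel symbol `γ` at `x`, in the directions
`u, v`. -/
def warpChristoffel (a b : ℝ) (γ : E) (y : F) (u v : E × F) : E × F :=
  (γ + (a / (1 + ‖y‖ ^ 2)) • ((inner ℝ y u.2 : ℝ) • v.1 + (inner ℝ y v.2 : ℝ) • u.1),
    (-(1 / (1 + ‖y‖ ^ 2))) • ((inner ℝ y u.2 : ℝ) • v.2 + (inner ℝ y v.2 : ℝ) • u.2) +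
      (capQ a (‖y‖ ^ 2) * inner ℝ u.2 v.2 + capL a (‖y‖ ^ 2) * (inner ℝ y u.2 * inner ℝ y v.2)
        - b / a) • y)

variable [FiniteDimensional ℝ E] [FiniteDimensional ℝ F]

theorem christoffel_warpAt (ha : 0 < a) (hg : LocalMetric.IsMetricOn g U) {p : E × F}
    (hp : p.1 ∈ U) (u v : E × F) :
    LocalMetric.christoffel (fun p : E × F ↦ warpAt a (g p.1) p.2) p u v =
      warpChristoffel a (g p.1 u.1 v.1) (LocalMetric.christoffel g p.1 u.1 v.1) p.2 u v := by
  refine LocalMetric.christoffel_eq_of_forall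
    ((isMetricOn_warpAt (F := F) ha hg).pos p ⟨hp, trivial⟩) fun z ↦ ?_
  rw [LocalMetric.christoffelFirst_apply, fderiv_warpAt ha hg hp, fderiv_warpAt ha hg hp,
    fderiv_warpAt ha hg hp, warpAt_apply]
  simp only [warpChristoffel, map_add, add_apply, hg.apply_christoffel hp,
    LocalMetric.christoffelFirst_apply, map_smul, smul_apply, smul_eq_mul, fderiv_capMetric,
    capMetric_apply, real_inner_self_eq_norm_sq]
  rw [hg.symm _ hp u.1 v.1, real_inner_comm u.2 v.2, real_inner_comm z.2 u.2,
    real_inner_comm z.2 v.2]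
  have hw := one_add_norm_sq_pos p.2
  have hX := (Real.rpow_pos_of_pos hw a).ne'
  have e1 := mul_quot a (‖p.2‖ ^ 2)
  unfold capQ capL
  generalize (1 + ‖p.2‖ ^ 2) ^ a = X at *
  generalize deriv (quot a) (‖p.2‖ ^ 2) = D' at *
  generalize quot a (‖p.2‖ ^ 2) = D at *
  generalize ‖p.2‖ ^ 2 = w at *
  generalize (inner ℝ p.2 u.2 : ℝ) = Tu
  generalize (inner ℝ p.2 v.2 : ℝ) = Tv
  generalize (inner ℝ p.2 z.2 : ℝ) = Tz
  generalize (inner ℝ u.2 v.2 : ℝ) = uv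
  obtain rfl : X = 1 + w * D := by linarith
  field_simp
  ring

end WarpedCone


namespace WarpedCone

/-! ### The Ricci curvature of the warped metric -/

variable {F : Type*} [NormedAddCommGroup F] [InnerProductSpace ℝ F]
variable {E : Type*} [NormedAddCommGroup E] [NormedSpace ℝ E]
  {g : E → E →L[ℝ] E →L[ℝ] ℝ} {U : Set E} {a : ℝ}
variable [FiniteDimensional ℝ E] [FiniteDimensional ℝ F]

theorem fderiv_christoffel_warpAt (ha : 0 < a) (hg : LocalMetric.IsMetricOn g U) {p : E × F}
    (hp : p.1 ∈ U) (u v z : E × F) :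
    fderiv ℝ (LocalMetric.christoffel (fun p : E × F ↦ warpAt a (g p.1) p.2)) p u v z =
      (fderiv ℝ (LocalMetric.christoffel g) p.1 u.1 v.1 z.1 +
          ((-(a / (1 + ‖p.2‖ ^ 2) ^ 2) * (2 * inner ℝ p.2 u.2)) •
              ((inner ℝ p.2 v.2 : ℝ) • z.1 + (inner ℝ p.2 z.2 : ℝ) • v.1) +
            (a / (1 + ‖p.2‖ ^ 2)) • ((inner ℝ u.2 v.2 : ℝ) • z.1 + (inner ℝ u.2 z.2 : ℝ) • v.1)),
        (1 / (1 + ‖p.2‖ ^ 2) ^ 2 * (2 * inner ℝ p.2 u.2)) •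
            ((inner ℝ p.2 v.2 : ℝ) • z.2 + (inner ℝ p.2 z.2 : ℝ) • v.2) +
          (-(1 / (1 + ‖p.2‖ ^ 2))) • ((inner ℝ u.2 v.2 : ℝ) • z.2 + (inner ℝ u.2 z.2 : ℝ) • v.2) +
          ((deriv (capQ a) (‖p.2‖ ^ 2) * (2 * inner ℝ p.2 u.2) * inner ℝ v.2 z.2 +
                (deriv (capL a) (‖p.2‖ ^ 2) * (2 * inner ℝ p.2 u.2) *
                    (inner ℝ p.2 v.2 * inner ℝ p.2 z.2) +
                  capL a (‖p.2‖ ^ 2) *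
                    (inner ℝ u.2 v.2 * inner ℝ p.2 z.2 + inner ℝ p.2 v.2 * inner ℝ u.2 z.2)) -
                fderiv ℝ g p.1 u.1 v.1 z.1 / a) • p.2 +
            (capQ a (‖p.2‖ ^ 2) * inner ℝ v.2 z.2 +
              capL a (‖p.2‖ ^ 2) * (inner ℝ p.2 v.2 * inner ℝ p.2 z.2) - g p.1 v.1 z.1 / a) •
                u.2)) := by
  have hd := (isMetricOn_warpAt (F := F) ha hg).differentiableAt_christoffel (y := p) ⟨hp, trivial⟩
  rw [LocalMetric.fderiv_apply_apply hd]
  refine fderiv_eq_of_hasDerivAt_line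
    ((hd.clm_apply (differentiableAt_const v)).clm_apply (differentiableAt_const z)) ?_
  have hev : (fun t : ℝ ↦ LocalMetric.christoffel (fun p : E × F ↦ warpAt a (g p.1) p.2)
      (p + t • u) v z) =ᶠ[𝓝 0] fun t ↦ warpChristoffel a (g (p.1 + t • u.1) v.1 z.1)
        (LocalMetric.christoffel g (p.1 + t • u.1) v.1 z.1) (p.2 + t • u.2) v z := by
    have hc : Filter.Tendsto (fun t : ℝ ↦ p.1 + t • u.1) (𝓝 0) (𝓝 p.1) := by
      have := (hasDerivAt_line p.1 u.1).continuousAt.tendsto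
      simpa using this
    filter_upwards [hc (hg.isOpen.mem_nhds hp)] with t ht
    exact christoffel_warpAt ha hg (p := p + t • u) ht v z
  refine HasDerivAt.congr_of_eventuallyEq ?_ hev
  have hw := one_add_norm_sq_pos p.2
  have hgd := hg.differentiableAt hp
  have hΓd := hg.differentiableAt_christoffel hp
  have hg' : HasDerivAt (fun t : ℝ ↦ g (p.1 + t • u.1) v.1 z.1) (fderiv ℝ g p.1 u.1 v.1 z.1) 0 := by
    rw [LocalMetric.fderiv_apply_apply hgd]
    exact ((hgd.clm_apply (differentiableAt_const v.1)).clm_apply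
      (differentiableAt_const z.1)).hasFDerivAt.hasLineDerivAt u.1
  have hΓ' : HasDerivAt (fun t : ℝ ↦ LocalMetric.christoffel g (p.1 + t • u.1) v.1 z.1)
      (fderiv ℝ (LocalMetric.christoffel g) p.1 u.1 v.1 z.1) 0 := by
    rw [LocalMetric.fderiv_apply_apply hΓd]
    exact ((hΓd.clm_apply (differentiableAt_const v.1)).clm_apply
      (differentiableAt_const z.1)).hasFDerivAt.hasLineDerivAt u.1
  have hv := hasDerivAt_inner_line p.2 u.2 v.2
  have hz := hasDerivAt_inner_line p.2 u.2 z.2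
  have hQ := hasDerivAt_radial_line (differentiableAt_capQ (a := a) hw).hasDerivAt u.2
  have hL := hasDerivAt_radial_line (differentiableAt_capL (a := a) hw).hasDerivAt u.2
  have hA := hasDerivAt_radial_line (hasDerivAt_div_one_add a hw) u.2
  have hB := (hasDerivAt_radial_line (hasDerivAt_div_one_add 1 hw) u.2).neg
  have hl := hasDerivAt_line p.2 u.2
  have h1 := hΓ'.add (hA.smul ((hv.smul_const z.1).add (hz.smul_const v.1)))
  have h2 := (hB.smul ((hv.smul_const z.2).add (hz.smul_const v.2))).add
    ((((hQ.mul_const (inner ℝ v.2 z.2)).add (hL.mul (hv.mul hz))).sub (hg'.div_const a)).smul hl)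
  have h3 := h1.prodMk h2
  convert! h3 using 1
  ext
  · simp [add_comm]
  · simp; abel

theorem ricci_warpAt (ha : 0 < a) (hg : LocalMetric.IsMetricOn g U) {p : E × F} (hp : p.1 ∈ U)
    (hdim : a * ((Module.finrank ℝ E : ℝ) - 1) = Module.finrank ℝ F) (v : E × F) :
    LocalMetric.ricci (fun p : E × F ↦ warpAt a (g p.1) p.2) p v v =
      LocalMetric.ricci g p.1 v.1 v.1 - ((Module.finrank ℝ E : ℝ) - 1) * g p.1 v.1 v.1 +
      ((Module.finrank ℝ F : ℝ) - 2) * (capQ a (‖p.2‖ ^ 2) * ‖v.2‖ ^ 2 +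
        (capL a (‖p.2‖ ^ 2) - (1 + a) / (1 + ‖p.2‖ ^ 2) ^ 2) * inner ℝ p.2 v.2 ^ 2) := by
  rw [LocalMetric.ricci, LinearMap.trace_prod]
  obtain ⟨x, y⟩ := p
  obtain ⟨v1, v2⟩ := v
  have hw := one_add_norm_sq_pos y
  have h1 : LinearMap.fst ℝ E F ∘ₗ LocalMetric.curvature (fun p : E × F ↦ warpAt a (g p.1) p.2)
      (x, y) (v1, v2) (v1, v2) ∘ₗ LinearMap.inl ℝ E F =
      LocalMetric.curvature g x v1 v1 +
      (-(a * ‖v2‖ ^ 2 / (1 + ‖y‖ ^ 2)) + 2 * a * inner ℝ y v2 ^ 2 / (1 + ‖y‖ ^ 2) ^ 2 +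
        a / (1 + ‖y‖ ^ 2) * (-2 / (1 + ‖y‖ ^ 2) * inner ℝ y v2 ^ 2 +
          (capQ a (‖y‖ ^ 2) * ‖v2‖ ^ 2 + capL a (‖y‖ ^ 2) * inner ℝ y v2 ^ 2
            - g x v1 v1 / a) * ‖y‖ ^ 2) -
        (a / (1 + ‖y‖ ^ 2)) ^ 2 * inner ℝ y v2 ^ 2) • LinearMap.id +
      (a / (1 + ‖y‖ ^ 2) * (‖y‖ ^ 2 / a)) • ((g x v1 : E →ₗ[ℝ] ℝ).smulRight v1) := by
    refine LinearMap.ext fun u ↦ ?_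
    simp only [LinearMap.comp_apply, LinearMap.fst_apply, LinearMap.inl_apply,
      LocalMetric.curvature, LinearMap.coe_mk, AddHom.coe_mk, LinearMap.add_apply,
      LinearMap.smul_apply, LinearMap.id_apply, LinearMap.smulRight_apply,
      fderiv_christoffel_warpAt ha hg (p := (x, y)) hp, christoffel_warpAt ha hg (p := (x, y)) hp,
      warpChristoffel, Prod.fst_add, Prod.fst_sub, inner_zero_left, inner_zero_right,
      inner_add_right, real_inner_smul_right, real_inner_self_eq_norm_sq, map_add, map_smul,
      zero_smul, smul_zero, add_zero, zero_add, mul_zero, ContinuousLinearMap.coe_coe]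
    rw [hg.symm x hp u v1, hg.christoffel_comm hp u v1]
    module
  have h2 : LinearMap.snd ℝ E F ∘ₗ LocalMetric.curvature (fun p : E × F ↦ warpAt a (g p.1) p.2)
      (x, y) (v1, v2) (v1, v2) ∘ₗ LinearMap.inr ℝ E F =
      (capQ a (‖y‖ ^ 2) * ‖v2‖ ^ 2 + capL a (‖y‖ ^ 2) * inner ℝ y v2 ^ 2 - g x v1 v1 / a -
          2 / (1 + ‖y‖ ^ 2) ^ 2 * inner ℝ y v2 ^ 2 + 1 / (1 + ‖y‖ ^ 2) * ‖v2‖ ^ 2 -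
          1 / (1 + ‖y‖ ^ 2) * (-2 / (1 + ‖y‖ ^ 2) * inner ℝ y v2 ^ 2 +
            (capQ a (‖y‖ ^ 2) * ‖v2‖ ^ 2 + capL a (‖y‖ ^ 2) * inner ℝ y v2 ^ 2
              - g x v1 v1 / a) * ‖y‖ ^ 2) -
          1 / (1 + ‖y‖ ^ 2) ^ 2 * inner ℝ y v2 ^ 2) • LinearMap.id +
        ((inner ℝ y v2 * (2 / (1 + ‖y‖ ^ 2) ^ 2 - capL a (‖y‖ ^ 2) - 1 / (1 + ‖y‖ ^ 2) ^ 2 +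
            1 / (1 + ‖y‖ ^ 2) * ‖y‖ ^ 2 * capL a (‖y‖ ^ 2))) • (innerForm F y : F →ₗ[ℝ] ℝ) +
          (-(1 / (1 + ‖y‖ ^ 2)) - capQ a (‖y‖ ^ 2) +
            1 / (1 + ‖y‖ ^ 2) * ‖y‖ ^ 2 * capQ a (‖y‖ ^ 2)) •
              (innerForm F v2 : F →ₗ[ℝ] ℝ)).smulRight v2 +
        ((2 * deriv (capQ a) (‖y‖ ^ 2) * ‖v2‖ ^ 2 - capL a (‖y‖ ^ 2) * ‖v2‖ ^ 2 +
            (capQ a (‖y‖ ^ 2) - 1 / (1 + ‖y‖ ^ 2)) * (capQ a (‖y‖ ^ 2) * ‖v2‖ ^ 2 +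
              capL a (‖y‖ ^ 2) * inner ℝ y v2 ^ 2 - g x v1 v1 / a) +
            capL a (‖y‖ ^ 2) * (-2 / (1 + ‖y‖ ^ 2) * inner ℝ y v2 ^ 2 +
              (capQ a (‖y‖ ^ 2) * ‖v2‖ ^ 2 + capL a (‖y‖ ^ 2) * inner ℝ y v2 ^ 2
                - g x v1 v1 / a) * ‖y‖ ^ 2) +
            1 / (1 + ‖y‖ ^ 2) * capL a (‖y‖ ^ 2) * inner ℝ y v2 ^ 2 -
            capQ a (‖y‖ ^ 2) * (-(1 / (1 + ‖y‖ ^ 2)) * ‖v2‖ ^ 2 +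
              capL a (‖y‖ ^ 2) * inner ℝ y v2 ^ 2) -
            capL a (‖y‖ ^ 2) * inner ℝ y v2 ^ 2 * (-2 / (1 + ‖y‖ ^ 2) +
              ‖y‖ ^ 2 * capL a (‖y‖ ^ 2)) +
            a / (1 + ‖y‖ ^ 2) * (g x v1 v1 / a)) • (innerForm F y : F →ₗ[ℝ] ℝ) +
          (inner ℝ y v2 * (capL a (‖y‖ ^ 2) - 2 * deriv (capQ a) (‖y‖ ^ 2) -
            1 / (1 + ‖y‖ ^ 2) * capQ a (‖y‖ ^ 2) - capQ a (‖y‖ ^ 2) *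
              (-(1 / (1 + ‖y‖ ^ 2)) + capQ a (‖y‖ ^ 2)) -
            capL a (‖y‖ ^ 2) * ‖y‖ ^ 2 * capQ a (‖y‖ ^ 2))) •
              (innerForm F v2 : F →ₗ[ℝ] ℝ)).smulRight y := by
    refine LinearMap.ext fun u ↦ ?_
    simp only [LinearMap.comp_apply, LinearMap.snd_apply, LinearMap.inr_apply,
      LocalMetric.curvature, LinearMap.coe_mk, AddHom.coe_mk, LinearMap.add_apply,
      LinearMap.smul_apply, LinearMap.id_apply, LinearMap.smulRight_apply,
      fderiv_christoffel_warpAt ha hg (p := (x, y)) hp, christoffel_warpAt ha hg (p := (x, y)) hp,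
      warpChristoffel, Prod.snd_add, Prod.snd_sub,
      inner_add_right, real_inner_smul_right, real_inner_self_eq_norm_sq, map_add, map_smul,
      smul_zero, add_zero, zero_add, mul_zero, ContinuousLinearMap.coe_coe, map_zero,
      zero_apply, zero_div, sub_zero, innerForm_apply, smul_eq_mul]
    rw [real_inner_comm v2 u, real_inner_comm y v2, real_inner_comm y u]
    generalize 1 + ‖y‖ ^ 2 = N
    module
  rw [h1, h2]
  simp only [map_add, map_smul, LinearMap.trace_smulRight, LinearMap.trace_id, smul_eq_mul,
    LinearMap.add_apply, LinearMap.smul_apply, ContinuousLinearMap.coe_coe, innerForm_apply,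
    real_inner_self_eq_norm_sq, real_inner_comm y v2]
  rw [← LocalMetric.ricci]
  have e1 := mul_capQ (a := a) hw
  have e2 := capQ_add_mul_capL (a := a) hw
  have e3 := capQ_add_mul_deriv (a := a) hw
  have hX := (Real.rpow_pos_of_pos hw a).ne'
  rcases eq_or_ne y 0 with rfl | hy
  · simp only [norm_zero, ne_eq, OfNat.ofNat_ne_zero, not_false_eq_true, zero_pow, add_zero,
      zero_mul, div_one, inner_zero_left] at e2 ⊢
    rw [← hdim, e2]
    field_simp
    ring
  have hy' : ‖y‖ ^ 2 ≠ 0 := by simpa using hy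
  generalize (1 + ‖y‖ ^ 2) ^ a = X at *
  generalize deriv (capQ a) (‖y‖ ^ 2) = Q' at *
  generalize capQ a (‖y‖ ^ 2) = Q at *
  generalize capL a (‖y‖ ^ 2) = L at *
  generalize ‖y‖ ^ 2 = w at *
  generalize ‖v2‖ ^ 2 = vv at *
  generalize (inner ℝ y v2 : ℝ) = ξ at *
  generalize (Module.finrank ℝ E : ℝ) = n at *
  generalize (Module.finrank ℝ F : ℝ) = m at *
  generalize g x v1 v1 = γ at *
  clear h1 h2
  have eQ : Q' = ((a + 1) / (1 + w) * (1 - w * Q) - Q) / w := by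
    rw [eq_div_iff hy', e1]
    linear_combination (norm := skip) e3
    field_simp
    ring
  have eL : L = ((a + 1) / (1 + w) - Q) / w := by
    rw [eq_div_iff hy']
    linear_combination e2
  clear e1 e2 e3
  subst eQ eL hdim
  have hw' := hw.ne'
  field_simp
  ring

theorem ricci_warpAt_nonneg (ha : 0 < a) (hg : LocalMetric.IsMetricOn g U) {p : E × F}
    (hp : p.1 ∈ U) (hdim : a * ((Module.finrank ℝ E : ℝ) - 1) = Module.finrank ℝ F)
    (hF : 2 ≤ Module.finrank ℝ F) {v : E × F}
    (hRic : ((Module.finrank ℝ E : ℝ) - 1) * g p.1 v.1 v.1 ≤ LocalMetric.ricci g p.1 v.1 v.1) :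
    0 ≤ LocalMetric.ricci (fun p : E × F ↦ warpAt a (g p.1) p.2) p v v := by
  rw [ricci_warpAt ha hg hp hdim]
  have hm : (0 : ℝ) ≤ (Module.finrank ℝ F : ℝ) - 2 := by
    have : (2 : ℝ) ≤ Module.finrank ℝ F := by exact_mod_cast hF
    linarith
  refine add_nonneg (by linarith) (mul_nonneg hm ?_)
  have hw := one_add_norm_sq_pos p.2
  have hQ := capQ_nonneg ha.le (sq_nonneg ‖p.2‖)
  have e2 := capQ_add_mul_capL (a := a) hw
  have hcs : inner ℝ p.2 v.2 ^ 2 ≤ ‖p.2‖ ^ 2 * ‖v.2‖ ^ 2 := by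
    rw [← mul_pow, sq_le_sq, abs_mul, abs_norm, abs_norm]
    exact abs_real_inner_le_norm _ _
  rcases (sq_nonneg ‖p.2‖).eq_or_lt with h0 | h0
  · have : inner ℝ p.2 v.2 ^ 2 = 0 := le_antisymm (by rw [← h0] at hcs; simpa using hcs)
      (sq_nonneg _)
    rw [this, mul_zero, add_zero]; positivity
  · have hξ := sq_nonneg (inner ℝ p.2 v.2 : ℝ)
    generalize ‖p.2‖ ^ 2 = w at *
    generalize (inner ℝ p.2 v.2 : ℝ) ^ 2 = ξ at *
    generalize ‖v.2‖ ^ 2 = vv at *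
    have eL : w * (capL a w - (1 + a) / (1 + w) ^ 2) = (1 + a) / (1 + w) ^ 2 - capQ a w := by
      linear_combination (norm := skip) e2
      field_simp
      ring
    have h1 : 0 ≤ w * vv - ξ := by linarith
    have h3 : 0 ≤ (1 + a) / (1 + w) ^ 2 := by positivity
    have h4 : w * (capQ a w * vv + (capL a w - (1 + a) / (1 + w) ^ 2) * ξ) =
        capQ a w * (w * vv - ξ) + (1 + a) / (1 + w) ^ 2 * ξ := by
      linear_combination ξ * eL
    exact nonneg_of_mul_nonneg_right (by rw [h4]; positivity) h0

end WarpedCone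


namespace SmoothMetric

open scoped Bundle
open Bundle

variable {E : Type*} [NormedAddCommGroup E] [NormedSpace ℝ E]
  {H : Type*} [TopologicalSpace H] {I : ModelWithCorners ℝ E H}
  {M : Type*} [TopologicalSpace M] [ChartedSpace H M] [IsManifold I ∞ M]

/-- A family of bilinear forms on the tangent spaces, read in the preferred chart at `x`. -/
def formInChart (φ : ∀ x : M, TangentSpace I x →L[ℝ] TangentSpace I x →L[ℝ] ℝ) (x : M) (y : E) :
    E →L[ℝ] E →L[ℝ] ℝ :=
  let A : E →L[ℝ] TangentSpace I ((extChartAt I x).symm y) :=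
    mfderiv 𝓘(ℝ, E) I (extChartAt I x).symm y
  (ContinuousLinearMap.precomp ℝ A) ∘L (φ ((extChartAt I x).symm y)) ∘L A

omit [IsManifold I ∞ M] in
theorem formInChart_apply (φ : ∀ x : M, TangentSpace I x →L[ℝ] TangentSpace I x →L[ℝ] ℝ) (x : M)
    (y u v : E) :
    formInChart φ x y u v = φ ((extChartAt I x).symm y)
      (mfderiv 𝓘(ℝ, E) I (extChartAt I x).symm y u)
      (mfderiv 𝓘(ℝ, E) I (extChartAt I x).symm y v) := rfl

variable [I.Boundaryless]

theorem trivializationAt_form (φ : ∀ x : M, TangentSpace I x →L[ℝ] TangentSpace I x →L[ℝ] ℝ)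
    {x₀ x : M} (hx : x ∈ (chartAt H x₀).source) :
    (trivializationAt (E →L[ℝ] E →L[ℝ] ℝ)
      (fun x : M ↦ TangentSpace I x →L[ℝ] TangentSpace I x →L[ℝ] ℝ) x₀ ⟨x, φ x⟩).2 =
      formInChart φ x₀ (extChartAt I x₀ x) := by
  have hinv : (extChartAt I x₀).symm (extChartAt I x₀ x) = x :=
    (extChartAt I x₀).left_inv (by simpa using hx)
  have hsymm := TangentBundle.symmL_trivializationAt (I := I) (𝕜 := ℝ) hx
  rw [I.range_eq_univ, mfderivWithin_univ] at hsymm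
  ext u v
  rw [hom_trivializationAt_apply]
  have h1 : x ∈ (trivializationAt E (TangentSpace I) x₀).baseSet := by simpa using hx
  have h2 := inCoordinates_apply_eq₂ (𝕜 := ℝ) (E₃ := fun _ : M ↦ ℝ) (F₃ := ℝ) (ϕ := φ x)
    (v := u) (w := v) h1 h1 (Set.mem_univ _)
  refine h2.trans ?_
  rw [formInChart_apply]
  have h3 (x' : M) (h : x' = x) (u' v' : E) :
      φ x' (u' : TangentSpace I x') (v' : TangentSpace I x') =
        φ x (u' : TangentSpace I x) (v' : TangentSpace I x) := by subst h; rfl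
  have h4 (w : E) : (trivializationAt E (TangentSpace I) x₀).symm x w =
      mfderiv 𝓘(ℝ, E) I (extChartAt I x₀).symm (extChartAt I x₀ x) w :=
    (Trivialization.symmL_apply _ h1 w).symm.trans congr($hsymm w)
  rw [h4, h4]
  simp only [Trivial.fiberBundle_trivializationAt', Trivial.linearMapAt_trivialization,
    LinearMap.id_apply]
  exact (h3 _ hinv _ _).symm

theorem contMDiff_form_iff (φ : ∀ x : M, TangentSpace I x →L[ℝ] TangentSpace I x →L[ℝ] ℝ) :
    ContMDiff I (I.prod 𝓘(ℝ, E →L[ℝ] E →L[ℝ] ℝ)) ∞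
      (fun x ↦ TotalSpace.mk' (E →L[ℝ] E →L[ℝ] ℝ) x (φ x)) ↔
    ∀ x, ContDiffOn ℝ ∞ (formInChart φ x) (extChartAt I x).target := by
  constructor
  · intro h x₀
    rw [← contMDiffOn_iff_contDiffOn]
    have h1 : ContMDiffOn I 𝓘(ℝ, E →L[ℝ] E →L[ℝ] ℝ) ∞ (fun x ↦
        (trivializationAt (E →L[ℝ] E →L[ℝ] ℝ)
          (fun x : M ↦ TangentSpace I x →L[ℝ] TangentSpace I x →L[ℝ] ℝ) x₀ ⟨x, φ x⟩).2)
        (chartAt H x₀).source := by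
      refine (Trivialization.contMDiffOn_section_iff _ (chartAt H x₀).open_source ?_).1
        h.contMDiffOn
      intro x hx
      simpa using hx
    have h2 := h1.comp (contMDiffOn_extChartAt_symm x₀) (fun y hy ↦ by
      simpa using (extChartAt I x₀).map_target hy)
    refine h2.congr fun y hy ↦ ?_
    have hy' : (extChartAt I x₀).symm y ∈ (chartAt H x₀).source := by
      simpa using (extChartAt I x₀).map_target hy
    rw [Function.comp_apply, trivializationAt_form φ hy', (extChartAt I x₀).right_inv hy]
  · intro h x₀
    rw [contMDiffAt_section]
    have h1 : ContMDiffAt I 𝓘(ℝ, E →L[ℝ] E →L[ℝ] ℝ) ∞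
        (fun x ↦ formInChart φ x₀ (extChartAt I x₀ x)) x₀ := by
      have h2 : ContMDiffAt 𝓘(ℝ, E) 𝓘(ℝ, E →L[ℝ] E →L[ℝ] ℝ) ∞ (formInChart φ x₀)
          (extChartAt I x₀ x₀) :=
        ((h x₀).contDiffAt (extChartAt_target_mem_nhds x₀)).contMDiffAt
      exact h2.comp x₀ contMDiffAt_extChartAt
    refine h1.congr_of_eventuallyEq ?_
    filter_upwards [chart_source_mem_nhds H x₀] with x hx using trivializationAt_form φ hx

theorem isMetricOn_inChart [FiniteDimensional ℝ E] (g : SmoothMetric I M) (x : M) :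
    LocalMetric.IsMetricOn (g.inChart x) (extChartAt I x).target where
  isOpen := isOpen_extChartAt_target x
  contDiffOn := (contMDiff_form_iff g.inner).1 g.contMDiff x
  symm y _ v w := g.symm _ _ _
  pos y hy v hv := by
    refine g.pos _ _ fun h0 ↦ hv ?_
    have h := isInvertible_mfderivWithin_extChartAt_symm (I := I) (x := x) hy
    rw [I.range_eq_univ, mfderivWithin_univ] at h
    exact h.injective (h0.trans (map_zero _).symm)

end SmoothMetric


theorem isVonNBounded_of_pos {E : Type*} [NormedAddCommGroup E] [NormedSpace ℝ E]
    [FiniteDimensional ℝ E] {B : E →L[ℝ] E →L[ℝ] ℝ} (hB : ∀ v, v ≠ 0 → 0 < B v v) :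
    Bornology.IsVonNBounded ℝ {v : E | B v v < 1} := by
  rw [NormedSpace.isVonNBounded_iff]
  have : ProperSpace E := FiniteDimensional.proper ℝ E
  rcases (Metric.sphere (0 : E) 1).eq_empty_or_nonempty with h | hne
  · have hsub : ∀ v : E, v = 0 := by
      intro v
      by_contra hv
      have : (‖v‖⁻¹ • v) ∈ Metric.sphere (0 : E) 1 := by
        simp [norm_smul, norm_ne_zero_iff.2 hv]
      rw [h] at this
      exact this
    exact (Bornology.isBounded_singleton (x := (0 : E))).subset fun v _ ↦ hsub v
  · have hcont : Continuous fun v : E ↦ B v v := by fun_prop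
    obtain ⟨v₀, hv₀, hmin⟩ := (isCompact_sphere (0 : E) 1).exists_isMinOn hne hcont.continuousOn
    have hc : 0 < B v₀ v₀ := hB v₀ (by rintro rfl; simp at hv₀)
    rw [isBounded_iff_forall_norm_le]
    refine ⟨√(1 / B v₀ v₀), fun v hv ↦ Real.le_sqrt_of_sq_le ?_⟩
    rw [le_div_iff₀ hc]
    refine le_trans ?_ (le_of_lt hv)
    rcases eq_or_ne v 0 with rfl | hv0
    · simp
    have hn : ‖v‖ ≠ 0 := norm_ne_zero_iff.2 hv0
    have h1 : B v₀ v₀ ≤ B (‖v‖⁻¹ • v) (‖v‖⁻¹ • v) := hmin (by simp [norm_smul, hn])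
    simp only [map_smul, smul_apply, smul_eq_mul] at h1
    calc ‖v‖ ^ 2 * B v₀ v₀ ≤ ‖v‖ ^ 2 * (‖v‖⁻¹ * (‖v‖⁻¹ * B v v)) := by gcongr
      _ = B v v := by field_simp

namespace SmoothMetric

open WarpedCone

variable {E : Type*} [NormedAddCommGroup E] [NormedSpace ℝ E] [FiniteDimensional ℝ E]
  {H : Type*} [TopologicalSpace H] {I : ModelWithCorners ℝ E H}
  {M : Type*} [TopologicalSpace M] [ChartedSpace H M] [IsManifold I ∞ M]
  {F : Type*} [NormedAddCommGroup F] [InnerProductSpace ℝ F] [FiniteDimensional ℝ F]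

/-- The bilinear forms on `M × F` given by the warped product of `g` with the cap metric. -/
def warpForm (a : ℝ) (g : SmoothMetric I M) (p : M × F) :
    TangentSpace (I.prod 𝓘(ℝ, F)) p →L[ℝ] TangentSpace (I.prod 𝓘(ℝ, F)) p →L[ℝ] ℝ :=
  warpAt a (show E →L[ℝ] E →L[ℝ] ℝ from g.inner p.1) p.2

omit [FiniteDimensional ℝ E] [FiniteDimensional ℝ F] in
theorem warpForm_apply (a : ℝ) (g : SmoothMetric I M) (p : M × F)
    (u v : TangentSpace (I.prod 𝓘(ℝ, F)) p) :
    warpForm a g p u v = (1 + ‖p.2‖ ^ 2) ^ a * g.inner p.1 (Prod.fst u) (Prod.fst v) +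
      capMetric a p.2 (Prod.snd u) (Prod.snd v) :=
  warpAt_apply a (show E →L[ℝ] E →L[ℝ] ℝ from g.inner p.1) p.2 u v

variable [I.Boundaryless]

omit [FiniteDimensional ℝ E] [IsManifold I ∞ M] [FiniteDimensional ℝ F] [I.Boundaryless] in
theorem extChartAt_prod_self (p : M × F) :
    extChartAt (I.prod 𝓘(ℝ, F)) p = (extChartAt I p.1).prod (PartialEquiv.refl F) := by
  rw [extChartAt_prod, extChartAt_model_space_eq_id]

omit [FiniteDimensional ℝ E] [FiniteDimensional ℝ F] in
theorem mfderiv_extChartAt_symm_prod (p : M × F) {z : E × F}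
    (hz : z.1 ∈ (extChartAt I p.1).target) :
    mfderiv 𝓘(ℝ, E × F) (I.prod 𝓘(ℝ, F)) (extChartAt (I.prod 𝓘(ℝ, F)) p).symm z =
      (mfderiv 𝓘(ℝ, E) I (extChartAt I p.1).symm z.1).prodMap (ContinuousLinearMap.id ℝ F) := by
  have h1 : MDifferentiableAt 𝓘(ℝ, E) I (extChartAt I p.1).symm z.1 := by
    have := mdifferentiableWithinAt_extChartAt_symm (I := I) hz
    rwa [I.range_eq_univ, mdifferentiableWithinAt_univ] at this
  have h2 : ((extChartAt (I.prod 𝓘(ℝ, F)) p).symm : E × F → M × F) =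
      Prod.map (extChartAt I p.1).symm id := by
    rw [extChartAt_prod_self]; rfl
  rw [h2, modelWithCornersSelf_prod, ← chartedSpaceSelf_prod, mfderiv_prodMap h1 mdifferentiableAt_id,
    mfderiv_id]
  rfl

omit [FiniteDimensional ℝ E] [FiniteDimensional ℝ F] in
theorem formInChart_warpForm (a : ℝ) (g : SmoothMetric I M) (p : M × F) {z : E × F}
    (hz : z.1 ∈ (extChartAt I p.1).target) :
    formInChart (warpForm a g) p z = warpAt a (g.inChart p.1 z.1) z.2 := by
  refine ContinuousLinearMap.ext fun u ↦ ContinuousLinearMap.ext fun v ↦ ?_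
  rw [formInChart_apply, mfderiv_extChartAt_symm_prod p hz]
  have h2 : ((extChartAt (I.prod 𝓘(ℝ, F)) p).symm : E × F → M × F) z =
      ((extChartAt I p.1).symm z.1, z.2) := by
    rw [extChartAt_prod_self]; rfl
  rw [h2, warpForm_apply, warpAt_apply]
  rfl

omit [FiniteDimensional ℝ E] in
theorem inChart_apply_mfderiv_extChartAt (g : SmoothMetric I M) (x : M) (v w : TangentSpace I x) :
    g.inChart x (extChartAt I x x) (mfderiv I 𝓘(ℝ, E) (extChartAt I x) x v)
      (mfderiv I 𝓘(ℝ, E) (extChartAt I x) x w) = g.inner x v w := by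
  have h := mfderivWithin_extChartAt_symm_comp_mfderiv_extChartAt' (I := I)
    (mem_extChartAt_source (I := I) x)
  rw [I.range_eq_univ, mfderivWithin_univ] at h
  have h3 (x' : M) (h : x' = x) (u' v' : E) :
      g.inner x' (u' : TangentSpace I x') (v' : TangentSpace I x') =
        g.inner x (u' : TangentSpace I x) (v' : TangentSpace I x) := by subst h; rfl
  have h4 (w : TangentSpace I x) : mfderiv 𝓘(ℝ, E) I (extChartAt I x).symm (extChartAt I x x)
      (mfderiv I 𝓘(ℝ, E) (extChartAt I x) x w) = w := congr($h w)
  exact (h3 _ (extChartAt_to_inv x) _ _).trans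
    (congrArg₂ (fun u' v' : TangentSpace I x ↦ g.inner x u' v') (h4 v) (h4 w))

/-- The warped product metric on `M × F`. -/
def warp {a : ℝ} (ha : 0 < a) (g : SmoothMetric I M) : SmoothMetric (I.prod 𝓘(ℝ, F)) (M × F) where
  inner := warpForm a g
  symm p v w := by
    rw [warpForm_apply, warpForm_apply, g.symm, capMetric_symm]
  pos p v hv := warpAt_pos ha (g := (show E →L[ℝ] E →L[ℝ] ℝ from g.inner p.1)) (g.pos p.1) p.2 hv
  isVonNBounded p := isVonNBounded_of_pos (E := E × F) (B := warpForm a g p)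
    (fun v hv ↦ warpAt_pos ha (g := (show E →L[ℝ] E →L[ℝ] ℝ from g.inner p.1)) (g.pos p.1) p.2 hv)
  contMDiff := by
    refine (contMDiff_form_iff (warpForm a g)).2 fun p ↦ ?_
    have h := isMetricOn_warpAt (F := F) ha (g.isMetricOn_inChart p.1)
    have h' : (extChartAt (I.prod 𝓘(ℝ, F)) p).target = (extChartAt I p.1).target ×ˢ Set.univ := by
      rw [extChartAt_prod_self]; rfl
    rw [h']
    exact h.contDiffOn.congr fun z hz ↦ formInChart_warpForm a g p hz.1

theorem warp_inner_self {a : ℝ} (ha : 0 < a) (g : SmoothMetric I M) (p : M × F)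
    (v : TangentSpace (I.prod 𝓘(ℝ, F)) p) :
    (warp ha g).inner p v v = (1 + ‖p.2‖ ^ 2) ^ a * g.inner p.1 (Prod.fst v) (Prod.fst v) +
      capMetric a p.2 (Prod.snd v) (Prod.snd v) :=
  warpForm_apply a g p v v

theorem ricciGE_warp {a : ℝ} (ha : 0 < a) {g : SmoothMetric I M}
    (hdim : a * ((Module.finrank ℝ E : ℝ) - 1) = Module.finrank ℝ F)
    (hF : 2 ≤ Module.finrank ℝ F) (hg : g.RicciGE ((Module.finrank ℝ E : ℝ) - 1)) :
    (warp (F := F) ha g).RicciGE 0 := by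
  intro p v
  rw [zero_mul]
  have hp : (extChartAt (I.prod 𝓘(ℝ, F)) p p).1 ∈ (extChartAt I p.1).target := by
    simp
  have hEq : (warp ha g).inChart p =ᶠ[𝓝 (extChartAt (I.prod 𝓘(ℝ, F)) p p)]
      fun z ↦ warpAt a (g.inChart p.1 z.1) z.2 := by
    have h1 : (extChartAt I p.1).target ×ˢ (Set.univ : Set F) ∈
        𝓝 (extChartAt (I.prod 𝓘(ℝ, F)) p p) :=
      ((isOpen_extChartAt_target p.1).prod isOpen_univ).mem_nhds ⟨hp, trivial⟩
    filter_upwards [h1] with z hz using formInChart_warpForm a g p hz.1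
  have hfst : extChartAt (I.prod 𝓘(ℝ, F)) p p = (extChartAt I p.1 p.1, p.2) := by
    rw [extChartAt_prod_self]; rfl
  have hmf : mfderiv (I.prod 𝓘(ℝ, F)) 𝓘(ℝ, E × F) (extChartAt (I.prod 𝓘(ℝ, F)) p) p =
      (mfderiv I 𝓘(ℝ, E) (extChartAt I p.1) p.1).prodMap (ContinuousLinearMap.id ℝ F) := by
    have h1 : MDifferentiableAt I 𝓘(ℝ, E) (extChartAt I p.1) p.1 :=
      mdifferentiableAt_extChartAt (mem_chart_source H p.1)
    have h2 : (extChartAt (I.prod 𝓘(ℝ, F)) p : M × F → E × F) =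
        Prod.map (extChartAt I p.1) id := by
      rw [extChartAt_prod_self]; rfl
    rw [h2, modelWithCornersSelf_prod, ← chartedSpaceSelf_prod,
      mfderiv_prodMap h1 mdifferentiableAt_id, mfderiv_id]
    rfl
  refine (ricci_warpAt_nonneg ha (g.isMetricOn_inChart p.1) hp hdim hF ?_).trans_eq
    (LocalMetric.ricci_congr hEq _ _).symm
  rw [hfst, hmf]
  have h1 := hg p.1 v.1
  exact (congrArg (((Module.finrank ℝ E : ℝ) - 1) * ·)
    (inChart_apply_mfderiv_extChartAt g p.1 v.1 v.1)).le.trans h1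

end SmoothMetric


namespace SmoothMetric

open Set MeasureTheory
open scoped Bundle

variable {E : Type*} [NormedAddCommGroup E] [NormedSpace ℝ E]
  {H : Type*} [TopologicalSpace H] {I : ModelWithCorners ℝ E H}
  {M : Type*} [TopologicalSpace M] [ChartedSpace H M] [IsManifold I ∞ M]

/-- The extended Riemannian distance. -/
def edist (g : SmoothMetric I M) (x y : M) : ENNReal :=
  letI : Bundle.RiemannianBundle (fun x : M ↦ TangentSpace I x) := ⟨g.toRiemannianMetric⟩
  Manifold.riemannianEDist I x y

/-- The velocity of a curve. -/
def velocity (I : ModelWithCorners ℝ E H) (c : ℝ → M) (t : ℝ) : TangentSpace I (c t) :=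
  mfderiv 𝓘(ℝ, ℝ) I c t (1 : ℝ)

/-- The speed of a curve. -/
def speed (g : SmoothMetric I M) (c : ℝ → M) (t : ℝ) : ℝ :=
  √(g.inner (c t) (velocity I c t) (velocity I c t))

theorem inner_self_nonneg (g : SmoothMetric I M) (x : M) (v : TangentSpace I x) :
    0 ≤ g.inner x v v := by
  rcases eq_or_ne v 0 with rfl | hv
  · simp
  · exact (g.pos x v hv).le

theorem speed_nonneg (g : SmoothMetric I M) (c : ℝ → M) (t : ℝ) : 0 ≤ g.speed c t :=
  Real.sqrt_nonneg _

theorem speed_sq (g : SmoothMetric I M) (c : ℝ → M) (t : ℝ) :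
    g.speed c t ^ 2 = g.inner (c t) (velocity I c t) (velocity I c t) :=
  Real.sq_sqrt (inner_self_nonneg g _ _)

theorem continuous_speed (g : SmoothMetric I M) {c : ℝ → M} (hc : ContMDiff 𝓘(ℝ, ℝ) I 1 c) :
    Continuous (g.speed c) := by
  let : Bundle.RiemannianBundle (fun x : M ↦ TangentSpace I x) := ⟨g.toRiemannianMetric⟩
  have : IsContinuousRiemannianBundle E (fun x : M ↦ TangentSpace I x) :=
    ⟨g.inner, g.contMDiff.continuous, fun _ _ _ ↦ rfl⟩
  have h1 : Continuous (tangentMap 𝓘(ℝ, ℝ) I c) :=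
    (hc.contMDiff_tangentMap (m := 0) (by simp)).continuous
  have h2 : Continuous fun t : ℝ ↦ (⟨t, (1 : ℝ)⟩ : TangentBundle 𝓘(ℝ, ℝ) ℝ) := by
    have := (tangentBundleModelSpaceHomeomorph 𝓘(ℝ, ℝ)).symm.continuous.comp
      (Continuous.prodMk_left (Y := ℝ) (1 : ℝ))
    exact this
  have h3 : Continuous fun t ↦ (⟨c t, velocity I c t⟩ : TangentBundle I M) := h1.comp h2
  exact (Continuous.inner_bundle (F := E) (E := fun x : M ↦ TangentSpace I x) h3 h3).sqrt

theorem pathELength_eq (g : SmoothMetric I M) (c : ℝ → M) :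
    letI : Bundle.RiemannianBundle (fun x : M ↦ TangentSpace I x) := ⟨g.toRiemannianMetric⟩
    Manifold.pathELength I c 0 1 = ∫⁻ t in Ioo (0 : ℝ) 1, ENNReal.ofReal (g.speed c t) := by
  let : Bundle.RiemannianBundle (fun x : M ↦ TangentSpace I x) := ⟨g.toRiemannianMetric⟩
  rw [Manifold.pathELength_eq_lintegral_mfderiv_Ioo]
  refine lintegral_congr fun t ↦ ?_
  rw [← ofReal_norm, norm_eq_sqrt_real_inner]
  rfl

theorem edist_le_of_speed_le (g : SmoothMetric I M) {c : ℝ → M}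
    (hc : ContMDiffOn 𝓘(ℝ, ℝ) I 1 c (Icc 0 1)) {l l' : ℝ → ℝ} (hl : ContinuousOn l (Icc 0 1))
    (hl' : ∀ t ∈ Ioo (0 : ℝ) 1, HasDerivAt l (l' t) t)
    (hle : ∀ t ∈ Ioo (0 : ℝ) 1, g.speed c t ≤ l' t) :
    g.edist (c 0) (c 1) ≤ ENNReal.ofReal (l 1 - l 0) := by
  let : Bundle.RiemannianBundle (fun x : M ↦ TangentSpace I x) := ⟨g.toRiemannianMetric⟩
  refine (Manifold.riemannianEDist_le_pathELength hc rfl rfl zero_le_one).trans ?_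
  rw [pathELength_eq]
  have hpos : ∀ t ∈ Ioo (0 : ℝ) 1, 0 ≤ l' t := fun t ht ↦ (speed_nonneg g c t).trans (hle t ht)
  have hint : IntegrableOn l' (Ioc 0 1) :=
    intervalIntegral.integrableOn_deriv_of_nonneg hl hl' hpos
  have hint' : IntegrableOn l' (Ioo 0 1) := hint.mono_set Ioo_subset_Ioc_self
  calc ∫⁻ t in Ioo (0 : ℝ) 1, ENNReal.ofReal (g.speed c t)
      ≤ ∫⁻ t in Ioo (0 : ℝ) 1, ENNReal.ofReal (l' t) :=
        setLIntegral_mono' measurableSet_Ioo fun t ht ↦ ENNReal.ofReal_le_ofReal (hle t ht)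
    _ = ENNReal.ofReal (∫ t in Ioo (0 : ℝ) 1, l' t) :=
        (ofReal_integral_eq_lintegral_ofReal hint'
          ((ae_restrict_iff' measurableSet_Ioo).2 (Filter.Eventually.of_forall hpos))).symm
    _ = ENNReal.ofReal (l 1 - l 0) := by
        rw [← integral_Ioc_eq_integral_Ioo, ← intervalIntegral.integral_of_le zero_le_one,
          intervalIntegral.integral_eq_sub_of_hasDerivAt_of_le zero_le_one hl hl'
            ((intervalIntegrable_iff_integrableOn_Ioc_of_le zero_le_one).2 hint)]

theorem exists_curve_of_edist_lt (g : SmoothMetric I M) {x y : M} {r : ℝ}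
    (h : g.edist x y < ENNReal.ofReal r) :
    ∃ c : ℝ → M, ContMDiff 𝓘(ℝ, ℝ) I 1 c ∧ c 0 = x ∧ c 1 = y ∧ ∫ t in 0..1, g.speed c t < r := by
  let : Bundle.RiemannianBundle (fun x : M ↦ TangentSpace I x) := ⟨g.toRiemannianMetric⟩
  obtain ⟨c, h0, h1, hc, hlt, -⟩ :=
    Manifold.exists_lt_locally_constant_of_riemannianEDist_lt (I := I) (x := x) (y := y)
      h zero_lt_one
  refine ⟨c, hc, h0, h1, ?_⟩
  rw [pathELength_eq] at hlt
  have hcont := continuous_speed g hc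
  have hint : IntegrableOn (g.speed c) (Ioo 0 1) :=
    (hcont.integrableOn_Ioc (a := 0) (b := 1)).mono_set Ioo_subset_Ioc_self
  rw [← ofReal_integral_eq_lintegral_ofReal hint
    (Filter.Eventually.of_forall fun t ↦ speed_nonneg g c t)] at hlt
  rw [intervalIntegral.integral_of_le zero_le_one, integral_Ioc_eq_integral_Ioo]
  exact (ENNReal.ofReal_lt_ofReal_iff_of_nonneg
    (integral_nonneg fun t ↦ speed_nonneg g c t)).1 hlt

theorem edist_self (g : SmoothMetric I M) (x : M) : g.edist x x = 0 := by
  let : Bundle.RiemannianBundle (fun x : M ↦ TangentSpace I x) := ⟨g.toRiemannianMetric⟩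
  exact Manifold.riemannianEDist_self

theorem edist_comm (g : SmoothMetric I M) (x y : M) : g.edist x y = g.edist y x := by
  let : Bundle.RiemannianBundle (fun x : M ↦ TangentSpace I x) := ⟨g.toRiemannianMetric⟩
  exact Manifold.riemannianEDist_comm

theorem edist_triangle (g : SmoothMetric I M) (x y z : M) :
    g.edist x z ≤ g.edist x y + g.edist y z := by
  let : Bundle.RiemannianBundle (fun x : M ↦ TangentSpace I x) := ⟨g.toRiemannianMetric⟩
  exact Manifold.riemannianEDist_triangle

theorem eventually_edist_lt (g : SmoothMetric I M) (x : M) {r : ENNReal} (hr : 0 < r) :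
    ∀ᶠ y in 𝓝 x, g.edist x y < r := by
  let : Bundle.RiemannianBundle (fun x : M ↦ TangentSpace I x) := ⟨g.toRiemannianMetric⟩
  have : IsContinuousRiemannianBundle E (fun x : M ↦ TangentSpace I x) :=
    ⟨g.inner, g.contMDiff.continuous, fun _ _ _ ↦ rfl⟩
  exact eventually_riemannianEDist_lt I x hr

theorem edist_ne_top [PreconnectedSpace M] (g : SmoothMetric I M) (x y : M) :
    g.edist x y ≠ ⊤ := by
  have hclopen : IsClopen {z | g.edist x z ≠ ⊤} := by
    have key : ∀ z, ∀ᶠ w in 𝓝 z, (g.edist x w ≠ ⊤ ↔ g.edist x z ≠ ⊤) := by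
      intro z
      filter_upwards [eventually_edist_lt g z zero_lt_one] with w hw
      have hw' : g.edist z w ≠ ⊤ := (hw.trans ENNReal.one_lt_top).ne
      constructor
      · intro h
        refine ne_top_of_le_ne_top (ENNReal.add_ne_top.2 ⟨h, ?_⟩) (g.edist_triangle x w z)
        rwa [edist_comm]
      · intro h
        exact ne_top_of_le_ne_top (ENNReal.add_ne_top.2 ⟨h, hw'⟩) (g.edist_triangle x z w)
    constructor
    · rw [← isOpen_compl_iff, isOpen_iff_mem_nhds]
      intro z hz
      filter_upwards [key z] with w hw
      exact fun h ↦ hz (hw.1 h)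
    · rw [isOpen_iff_mem_nhds]
      intro z hz
      filter_upwards [key z] with w hw using hw.2 hz
  have := hclopen.eq_univ ⟨x, by simp [edist_self]⟩
  exact (this ▸ mem_univ y : y ∈ {z | g.edist x z ≠ ⊤})

theorem dist_eq (g : SmoothMetric I M) (x y : M) : g.dist x y = (g.edist x y).toReal := rfl

theorem dist_nonneg (g : SmoothMetric I M) (x y : M) : 0 ≤ g.dist x y := ENNReal.toReal_nonneg

theorem dist_self (g : SmoothMetric I M) (x : M) : g.dist x x = 0 := by
  rw [dist_eq, edist_self, ENNReal.toReal_zero]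

theorem dist_comm (g : SmoothMetric I M) (x y : M) : g.dist x y = g.dist y x := by
  rw [dist_eq, edist_comm, ← dist_eq]

theorem dist_triangle [PreconnectedSpace M] (g : SmoothMetric I M) (x y z : M) :
    g.dist x z ≤ g.dist x y + g.dist y z := by
  rw [dist_eq, dist_eq, dist_eq, ← ENNReal.toReal_add (edist_ne_top g x y) (edist_ne_top g y z)]
  exact ENNReal.toReal_mono (ENNReal.add_ne_top.2 ⟨edist_ne_top g x y, edist_ne_top g y z⟩)
    (edist_triangle g x y z)

theorem dist_le_of_speed_le (g : SmoothMetric I M) {c : ℝ → M}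
    (hc : ContMDiffOn 𝓘(ℝ, ℝ) I 1 c (Icc 0 1)) {l l' : ℝ → ℝ} (hl : ContinuousOn l (Icc 0 1))
    (hl' : ∀ t ∈ Ioo (0 : ℝ) 1, HasDerivAt l (l' t) t)
    (hle : ∀ t ∈ Ioo (0 : ℝ) 1, g.speed c t ≤ l' t) (hl01 : l 0 ≤ l 1) :
    g.dist (c 0) (c 1) ≤ l 1 - l 0 := by
  rw [dist_eq]
  exact ENNReal.toReal_le_of_le_ofReal (sub_nonneg.2 hl01) (edist_le_of_speed_le g hc hl hl' hle)

theorem exists_curve_of_dist_lt [PreconnectedSpace M] (g : SmoothMetric I M) {x y : M} {r : ℝ}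
    (h : g.dist x y < r) :
    ∃ c : ℝ → M, ContMDiff 𝓘(ℝ, ℝ) I 1 c ∧ c 0 = x ∧ c 1 = y ∧ ∫ t in 0..1, g.speed c t < r := by
  refine exists_curve_of_edist_lt g ?_
  rw [← ENNReal.ofReal_toReal (edist_ne_top g x y)]
  exact (ENNReal.ofReal_lt_ofReal_iff_of_nonneg ENNReal.toReal_nonneg).2 h

theorem dist_le_integral_speed (g : SmoothMetric I M) {c : ℝ → M}
    (hc : ContMDiff 𝓘(ℝ, ℝ) I 1 c) : g.dist (c 0) (c 1) ≤ ∫ t in 0..1, g.speed c t := by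
  have hcont := continuous_speed g hc
  have hd (t : ℝ) : HasDerivAt (fun t ↦ ∫ s in 0..t, g.speed c s) (g.speed c t) t :=
    intervalIntegral.integral_hasDerivAt_right (hcont.intervalIntegrable _ _)
      (hcont.stronglyMeasurableAtFilter _ _) hcont.continuousAt
  have := dist_le_of_speed_le g hc.contMDiffOn (l := fun t ↦ ∫ s in 0..t, g.speed c s)
    (fun t _ ↦ (hd t).continuousAt.continuousWithinAt) (fun t _ ↦ hd t) (fun t _ ↦ le_rfl)
    (by
      rw [intervalIntegral.integral_same]
      exact intervalIntegral.integral_nonneg zero_le_one fun t _ ↦ speed_nonneg g c t)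
  simpa using this

theorem exists_dist_le_of_isCompact [PreconnectedSpace M] (g : SmoothMetric I M) {K : Set M}
    (hK : IsCompact K) : ∃ C, ∀ x ∈ K, ∀ y ∈ K, g.dist x y ≤ C := by
  rcases K.eq_empty_or_nonempty with rfl | ⟨x₀, hx₀⟩
  · exact ⟨0, by simp⟩
  have key : ∀ z ∈ K, ∃ U ∈ 𝓝[K] z, ∃ C, ∀ w ∈ U, g.dist x₀ w ≤ C := by
    intro z hz
    refine ⟨{w | g.edist z w < 1}, mem_nhdsWithin_of_mem_nhds
      (eventually_edist_lt g z zero_lt_one), g.dist x₀ z + 1, fun w hw ↦ ?_⟩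
    refine (dist_triangle g x₀ z w).trans (add_le_add_right ?_ _)
    exact (ENNReal.toReal_mono ENNReal.one_ne_top (le_of_lt hw)).trans_eq ENNReal.toReal_one
  obtain ⟨C, hC⟩ : ∃ C, ∀ w ∈ K, g.dist x₀ w ≤ C :=
    hK.induction_on (p := fun s ↦ ∃ C, ∀ w ∈ s, g.dist x₀ w ≤ C) ⟨0, by simp⟩
      (fun s t hst ⟨C, hC⟩ ↦ ⟨C, fun w hw ↦ hC w (hst hw)⟩)
      (fun s t ⟨C, hC⟩ ⟨C', hC'⟩ ↦ ⟨max C C', fun w hw ↦ hw.elim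
        (fun h ↦ (hC w h).trans (le_max_left _ _)) (fun h ↦ (hC' w h).trans (le_max_right _ _))⟩)
      key
  exact ⟨C + C, fun x hx y hy ↦ (dist_triangle g x x₀ y).trans
    (add_le_add ((dist_comm g x x₀).trans_le (hC x hx)) (hC y hy))⟩

end SmoothMetric


/-! ### Planar geometry in polar coordinates -/

namespace MetricCone

open Set MeasureTheory

/-- The third side of a Euclidean triangle with sides `r`, `s` at the angle `φ`. -/
def chord (r s φ : ℝ) : ℝ := √(r ^ 2 + s ^ 2 - 2 * r * s * Real.cos φ)

theorem chord_eq_norm (r s φ : ℝ) : chord r s φ = ‖(s : ℂ) * Complex.exp (φ * Complex.I) - r‖ := by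
  rw [chord, Complex.norm_def, Complex.normSq_apply]
  congr 1
  simp only [Complex.exp_mul_I, Complex.sub_re, Complex.mul_re, Complex.ofReal_re, Complex.add_re,
    Complex.ofReal_im, Complex.sub_im, Complex.mul_im, Complex.add_im, Complex.I_re, Complex.I_im,
    Complex.cos_ofReal_re, Complex.sin_ofReal_re, Complex.cos_ofReal_im, Complex.sin_ofReal_im]
  linear_combination -s ^ 2 * (Real.sin_sq_add_cos_sq φ)

theorem norm_mul_exp {s : ℝ} (hs : 0 ≤ s) (φ : ℝ) : ‖(s : ℂ) * Complex.exp (φ * Complex.I)‖ = s := by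
  rw [norm_mul, Complex.norm_exp_ofReal_mul_I, mul_one, Complex.norm_real, Real.norm_of_nonneg hs]

theorem chord_nonneg (r s φ : ℝ) : 0 ≤ chord r s φ := Real.sqrt_nonneg _

theorem chord_sq (r s φ : ℝ) : chord r s φ ^ 2 = r ^ 2 + s ^ 2 - 2 * r * s * Real.cos φ := by
  refine Real.sq_sqrt ?_
  nlinarith [Real.sin_sq_add_cos_sq φ, sq_nonneg (r - s * Real.cos φ), sq_nonneg (s * Real.sin φ)]

theorem chord_le_add {r s : ℝ} (hr : 0 ≤ r) (hs : 0 ≤ s) (φ : ℝ) : chord r s φ ≤ r + s := by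
  rw [chord_eq_norm]
  refine (norm_sub_le _ _).trans ?_
  rw [norm_mul_exp hs, Complex.norm_real, Real.norm_of_nonneg hr, add_comm]

theorem abs_sub_le_chord {r s : ℝ} (hr : 0 ≤ r) (hs : 0 ≤ s) (φ : ℝ) : |r - s| ≤ chord r s φ := by
  rw [chord_eq_norm, abs_sub_comm]
  have := abs_norm_sub_norm_le ((s : ℂ) * Complex.exp (φ * Complex.I)) (r : ℂ)
  rwa [norm_mul_exp hs, Complex.norm_real, Real.norm_of_nonneg hr] at this

theorem abs_chord_sub_chord_le (r s r' s' φ : ℝ) :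
    |chord r s φ - chord r' s' φ| ≤ |r - r'| + |s - s'| := by
  rw [chord_eq_norm, chord_eq_norm]
  refine (abs_norm_sub_norm_le _ _).trans ?_
  have : (s : ℂ) * Complex.exp (φ * Complex.I) - r - (s' * Complex.exp (φ * Complex.I) - r') =
      ((s - s' : ℝ) : ℂ) * Complex.exp (φ * Complex.I) - ((r - r' : ℝ) : ℂ) := by
    push_cast; ring
  rw [this]
  refine (norm_sub_le _ _).trans ?_
  rw [norm_mul, Complex.norm_exp_ofReal_mul_I, mul_one, Complex.norm_real, Complex.norm_real,
    Real.norm_eq_abs, Real.norm_eq_abs, add_comm]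

theorem chord_mul {k : ℝ} (hk : 0 ≤ k) (r s φ : ℝ) :
    chord (k * r) (k * s) φ = k * chord r s φ := by
  rw [chord, chord, ← Real.sqrt_sq hk, ← Real.sqrt_mul (sq_nonneg k), Real.sqrt_sq hk]
  congr 1
  ring

theorem chord_mono {r s φ ψ : ℝ} (hr : 0 ≤ r) (hs : 0 ≤ s) (hφ : 0 ≤ φ) (hψ : ψ ≤ Real.pi)
    (h : φ ≤ ψ) : chord r s φ ≤ chord r s ψ := by
  refine Real.sqrt_le_sqrt ?_
  have := mul_le_mul_of_nonneg_left (Real.cos_le_cos_of_nonneg_of_le_pi hφ hψ h)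
    (by positivity : 0 ≤ 2 * r * s)
  linarith

/-- A curve in polar coordinates is at least as long as its chord. -/
theorem norm_polar_sub_le {r r' θ θ' σ : ℝ → ℝ} (hr : ∀ t, HasDerivAt r (r' t) t)
    (hθ : ∀ t, HasDerivAt θ (θ' t) t) (hr' : Continuous r') (hθ' : Continuous θ')
    (hσ : Continuous σ) (hσ0 : ∀ t, 0 ≤ σ t)
    (hle : ∀ t, r' t ^ 2 + r t ^ 2 * θ' t ^ 2 ≤ σ t ^ 2) {a b : ℝ} (hab : a ≤ b) :
    ‖(r b : ℂ) * Complex.exp (θ b * Complex.I) - r a * Complex.exp (θ a * Complex.I)‖ ≤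
      ∫ t in a..b, σ t := by
  have hrc : Continuous r := continuous_iff_continuousAt.2 fun t ↦ (hr t).continuousAt
  have hθc : Continuous θ := continuous_iff_continuousAt.2 fun t ↦ (hθ t).continuousAt
  have hd (t : ℝ) : HasDerivAt (fun t ↦ (r t : ℂ) * Complex.exp (θ t * Complex.I))
      ((r' t + r t * θ' t * Complex.I) * Complex.exp (θ t * Complex.I)) t := by
    have h1 := (hr t).ofReal_comp
    have h2 := (((hθ t).ofReal_comp).mul_const Complex.I).cexp
    exact (h1.mul h2).congr_deriv (by ring)
  have hcont : Continuous fun t ↦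
      ((r' t + r t * θ' t * Complex.I) * Complex.exp (θ t * Complex.I) : ℂ) := by
    fun_prop
  rw [← intervalIntegral.integral_eq_sub_of_hasDerivAt (fun t _ ↦ hd t)
    (hcont.intervalIntegrable _ _)]
  refine intervalIntegral.norm_integral_le_of_norm_le hab (Filter.Eventually.of_forall fun t _ ↦ ?_)
    (hσ.intervalIntegrable _ _)
  rw [norm_mul, Complex.norm_exp_ofReal_mul_I, mul_one]
  refine abs_le_of_sq_le_sq' ?_ (hσ0 t) |>.2
  rw [Complex.sq_norm, Complex.normSq_apply]
  simp only [Complex.add_re, Complex.ofReal_re, Complex.mul_re, Complex.I_re, Complex.ofReal_im,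
    Complex.I_im, Complex.add_im, Complex.mul_im]
  refine le_trans (le_of_eq ?_) (hle t)
  ring

theorem chord_le_integral {r r' θ' σ : ℝ → ℝ} (hr : ∀ t, HasDerivAt r (r' t) t)
    (hr' : Continuous r') (hθ' : Continuous θ') (hσ : Continuous σ) (hr0 : ∀ t, 0 ≤ r t)
    (hσ0 : ∀ t, 0 ≤ σ t) (hle : ∀ t, r' t ^ 2 + r t ^ 2 * θ' t ^ 2 ≤ σ t ^ 2) {d : ℝ}
    (hd0 : 0 ≤ d) (hd : d ≤ ∫ t in 0..1, θ' t) :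
    chord (r 0) (r 1) (min d Real.pi) ≤ ∫ t in 0..1, σ t := by
  set θ : ℝ → ℝ := fun t ↦ ∫ s in 0..t, θ' s with hθdef
  have hθ (t : ℝ) : HasDerivAt θ (θ' t) t :=
    intervalIntegral.integral_hasDerivAt_right (hθ'.intervalIntegrable _ _)
      (hθ'.stronglyMeasurableAtFilter _ _) hθ'.continuousAt
  have hθ0 : θ 0 = 0 := intervalIntegral.integral_same
  have key {a b : ℝ} (hab : a ≤ b) := norm_polar_sub_le hr hθ hr' hθ' hσ hσ0 hle hab
  rcases le_or_gt (θ 1) Real.pi with h | h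
  · rw [min_eq_left (hd.trans h)]
    refine (chord_mono (hr0 0) (hr0 1) hd0 h hd).trans ?_
    rw [chord_eq_norm]
    have := key zero_le_one
    rwa [hθ0, Complex.ofReal_zero, zero_mul, Complex.exp_zero, mul_one] at this
  · obtain ⟨t, ht, htθ⟩ : ∃ t ∈ Icc (0 : ℝ) 1, θ t = Real.pi :=
      intermediate_value_Icc zero_le_one
        (fun t _ ↦ (hθ t).continuousAt.continuousWithinAt)
        ⟨hθ0.trans_le Real.pi_pos.le, h.le⟩
    refine (chord_le_add (hr0 0) (hr0 1) _).trans ?_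
    rw [← intervalIntegral.integral_add_adjacent_intervals (hσ.intervalIntegrable 0 t)
      (hσ.intervalIntegrable t 1)]
    have h1 := key ht.1
    rw [htθ, hθ0, Complex.exp_pi_mul_I, Complex.ofReal_zero, zero_mul, Complex.exp_zero, mul_one,
      mul_neg_one, ← neg_add', norm_neg, ← Complex.ofReal_add, Complex.norm_real,
      Real.norm_of_nonneg (add_nonneg (hr0 t) (hr0 0))] at h1
    have h2 := (norm_sub_norm_le _ _).trans (key ht.2)
    rw [norm_mul_exp (hr0 1), norm_mul_exp (hr0 t)] at h2
    linarith

end MetricCone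

/-! ### Lower bounds for the distance of the warped product -/

namespace SmoothMetric

open WarpedCone Set MeasureTheory
open scoped Bundle

variable {E : Type*} [NormedAddCommGroup E] [NormedSpace ℝ E]
  {H : Type*} [TopologicalSpace H] {I : ModelWithCorners ℝ E H}
  {M : Type*} [TopologicalSpace M] [ChartedSpace H M] [IsManifold I ∞ M]
  {F : Type*} [NormedAddCommGroup F] [InnerProductSpace ℝ F]

omit [IsManifold I ∞ M] in
theorem velocity_prodMk {c : ℝ → M} {y : ℝ → F} {t : ℝ} (hc : MDifferentiableAt 𝓘(ℝ, ℝ) I c t)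
    (hy : DifferentiableAt ℝ y t) :
    velocity (I.prod 𝓘(ℝ, F)) (fun t ↦ (c t, y t)) t = (velocity I c t, deriv y t) := by
  have hy' : MDifferentiableAt 𝓘(ℝ, ℝ) 𝓘(ℝ, F) y t := hy.mdifferentiableAt
  rw [velocity, mfderiv_prodMk hc hy', mfderiv_eq_fderiv]
  rfl

theorem sq_inner_le_capMetric {a : ℝ} (ha : 0 ≤ a) (y v : F) :
    a ^ 2 * (1 + ‖y‖ ^ 2) ^ (a - 2) * inner ℝ y v ^ 2 ≤ capMetric a y v v := by
  rw [capMetric_apply, real_inner_self_eq_norm_sq]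
  have hN := one_add_norm_sq_pos y
  have h2 : (1 + ‖y‖ ^ 2) ^ (a - 2) = (1 + ‖y‖ ^ 2) ^ a / (1 + ‖y‖ ^ 2) ^ 2 := by
    rw [Real.rpow_sub hN]; norm_num
  have hq := mul_quot a (‖y‖ ^ 2)
  have hq0 := quot_nonneg ha (sq_nonneg ‖y‖)
  have hT : inner ℝ y v ^ 2 ≤ ‖y‖ ^ 2 * ‖v‖ ^ 2 := by
    rw [← mul_pow, ← sq_abs]
    gcongr
    exact abs_real_inner_le_norm y v
  rw [h2]
  set N := 1 + ‖y‖ ^ 2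
  set X := N ^ a
  have key : X * inner ℝ y v ^ 2 ≤ N * (‖v‖ ^ 2 + quot a (‖y‖ ^ 2) * inner ℝ y v ^ 2) := by
    have : X = ‖y‖ ^ 2 * quot a (‖y‖ ^ 2) + 1 := by rw [hq]; ring
    rw [this]
    have : 0 ≤ ‖v‖ ^ 2 := sq_nonneg _
    have h3 := mul_nonneg hq0 (sq_nonneg (inner ℝ y v))
    simp only [N]
    linarith
  calc a ^ 2 * (X / N ^ 2) * inner ℝ y v ^ 2 = a ^ 2 / N ^ 2 * (X * inner ℝ y v ^ 2) := by ring
    _ ≤ a ^ 2 / N ^ 2 * (N * (‖v‖ ^ 2 + quot a (‖y‖ ^ 2) * inner ℝ y v ^ 2)) := by gcongr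
    _ = _ := by field_simp

variable [FiniteDimensional ℝ E] [FiniteDimensional ℝ F] [I.Boundaryless]

theorem speed_warp_sq {a : ℝ} (ha : 0 < a) (g : SmoothMetric I M) {c : ℝ → M} {y : ℝ → F} {t : ℝ}
    (hc : MDifferentiableAt 𝓘(ℝ, ℝ) I c t) (hy : DifferentiableAt ℝ y t) :
    (warp ha g).speed (fun t ↦ (c t, y t)) t ^ 2 =
      (1 + ‖y t‖ ^ 2) ^ a * g.speed c t ^ 2 + capMetric a (y t) (deriv y t) (deriv y t) := by
  rw [speed_sq, speed_sq, warp_inner_self, velocity_prodMk hc hy]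

/-- The distance of the warped product is at least the cone distance, for the radius
`(1 + ‖y‖²) ^ (a / 2)`. -/
theorem chord_le_dist_warp [ConnectedSpace M] {a : ℝ} (ha : 0 < a) (g : SmoothMetric I M)
    (p q : M × F) :
    MetricCone.chord ((1 + ‖p.2‖ ^ 2) ^ (a / 2)) ((1 + ‖q.2‖ ^ 2) ^ (a / 2))
      (min (g.dist p.1 q.1) Real.pi) ≤ (warp ha g).dist p q := by
  refine le_of_forall_gt_imp_ge_of_dense fun L hL ↦ ?_
  obtain ⟨c, hc, rfl, rfl, hlt⟩ := exists_curve_of_dist_lt _ hL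
  obtain ⟨hc1, hc2⟩ := (contMDiff_prod_iff c).1 hc
  have hy : ContDiff ℝ 1 (Prod.snd ∘ c) := hc2.contDiff
  set x := Prod.fst ∘ c
  set y := Prod.snd ∘ c
  have hr (t : ℝ) : HasDerivAt (fun t ↦ (1 + ‖y t‖ ^ 2) ^ (a / 2))
      (a * (1 + ‖y t‖ ^ 2) ^ (a / 2 - 1) * inner ℝ (y t) (deriv y t)) t := by
    have h1 := ((hy.differentiable one_ne_zero t).hasDerivAt.norm_sq.const_add 1).rpow_const
      (p := a / 2) (Or.inl (one_add_norm_sq_pos (y t)).ne')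
    exact h1.congr_deriv (by ring)
  have hr' : Continuous fun t ↦ a * (1 + ‖y t‖ ^ 2) ^ (a / 2 - 1) * inner ℝ (y t) (deriv y t) := by
    have h1 : Continuous fun t ↦ (1 + ‖y t‖ ^ 2) ^ (a / 2 - 1) :=
      (continuous_const.add (hy.continuous.norm.pow 2)).rpow_const
        fun t ↦ Or.inl (one_add_norm_sq_pos (y t)).ne'
    exact (continuous_const.mul h1).mul (hy.continuous.inner (hy.continuous_deriv le_rfl))
  refine le_trans ?_ hlt.le
  refine MetricCone.chord_le_integral hr hr' (continuous_speed g hc1)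
    (continuous_speed _ hc) (fun t ↦ by positivity) (fun t ↦ speed_nonneg _ _ t) (fun t ↦ ?_)
    (dist_nonneg g _ _) (dist_le_integral_speed g hc1)
  have h1 := speed_warp_sq (a := a) ha g ((hc1 t).mdifferentiableAt one_ne_zero)
    (hy.differentiable one_ne_zero t)
  have hN := one_add_norm_sq_pos (y t)
  have h2 : ((1 + ‖y t‖ ^ 2) ^ (a / 2)) ^ 2 = (1 + ‖y t‖ ^ 2) ^ a := by
    rw [← Real.rpow_mul_natCast hN.le]; congr 1; push_cast; ring
  have h3 : ((1 + ‖y t‖ ^ 2) ^ (a / 2 - 1)) ^ 2 = (1 + ‖y t‖ ^ 2) ^ (a - 2) := by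
    rw [← Real.rpow_mul_natCast hN.le]; congr 1; push_cast; ring
  refine le_trans ?_ h1.ge
  rw [mul_pow, mul_pow, h2, h3, add_comm]
  gcongr
  exact sq_inner_le_capMetric ha.le _ _

theorem dist_warp_ge_abs_sub [ConnectedSpace M] {a : ℝ} (ha : 0 < a) (g : SmoothMetric I M)
    (p q : M × F) :
    |(1 + ‖p.2‖ ^ 2) ^ (a / 2) - (1 + ‖q.2‖ ^ 2) ^ (a / 2)| ≤ (warp ha g).dist p q :=
  (MetricCone.abs_sub_le_chord (by positivity) (by positivity) _).trans (chord_le_dist_warp ha g p q)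

theorem isComplete_warp [ConnectedSpace M] [CompactSpace M] [T3Space M] {a : ℝ} (ha : 0 < a)
    (g : SmoothMetric I M) : (warp (F := F) ha g).IsComplete := by
  let _ : Bundle.RiemannianBundle (fun x : M × F ↦ TangentSpace (I.prod 𝓘(ℝ, F)) x) :=
    ⟨(warp ha g).toRiemannianMetric⟩
  have : IsContinuousRiemannianBundle (E × F)
      (fun x : M × F ↦ TangentSpace (I.prod 𝓘(ℝ, F)) x) :=
    ⟨(warp ha g).inner, (warp ha g).contMDiff.continuous, fun _ _ _ ↦ rfl⟩
  let _ : EMetricSpace (M × F) := EMetricSpace.ofRiemannianMetric (I.prod 𝓘(ℝ, F)) (M × F)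
  change CompleteSpace (M × F)
  refine ⟨fun {f} hf ↦ ?_⟩
  obtain ⟨s, hs, hs'⟩ := EMetric.cauchy_iff.1 hf |>.2 1 one_pos
  have := hf.1
  obtain ⟨p, hp⟩ := f.nonempty_of_mem hs
  set R := (1 + ‖p.2‖ ^ 2) ^ (a / 2) + 1
  have hR : 0 ≤ R := by positivity
  set K : Set (M × F) := univ ×ˢ Metric.closedBall (0 : F) √(R ^ (2 / a))
  have hK : IsCompact K := isCompact_univ.prod (isCompact_closedBall _ _)
  have hsK : s ⊆ K := by
    intro q hq
    refine ⟨trivial, ?_⟩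
    rw [mem_closedBall_zero_iff]
    refine Real.le_sqrt_of_sq_le ?_
    have h1 : (warp ha g).edist p q < 1 := hs' p hp q hq
    have h2 : (warp ha g).dist p q ≤ 1 :=
      (ENNReal.toReal_mono ENNReal.one_ne_top h1.le).trans_eq ENNReal.toReal_one
    have h3 := (abs_le.1 (dist_warp_ge_abs_sub ha g p q)).1
    have h4 : (1 + ‖q.2‖ ^ 2) ^ (a / 2) ≤ R := by linarith
    have h5 : 1 + ‖q.2‖ ^ 2 ≤ R ^ (2 / a) := by
      have := Real.rpow_le_rpow (by positivity) h4 (by positivity : 0 ≤ 2 / a)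
      rwa [← Real.rpow_mul (by positivity), show a / 2 * (2 / a) = 1 by field_simp,
        Real.rpow_one] at this
    linarith
  obtain ⟨q, -, hq⟩ := hK.isComplete f hf (Filter.le_principal_iff.2 (f.mem_of_superset hs hsK))
  exact ⟨q, hq⟩

end SmoothMetric


namespace MetricCone

open Set

theorem chord_pi {r s : ℝ} (hr : 0 ≤ r) (hs : 0 ≤ s) : chord r s Real.pi = r + s := by
  rw [chord, Real.cos_pi, ← Real.sqrt_sq (add_nonneg hr hs)]
  congr 1
  ring

theorem continuous_chord (r s : ℝ) : Continuous (chord r s) := by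
  unfold chord
  fun_prop

theorem sub_mul_cos_le_chord (r s φ : ℝ) : r - s * Real.cos φ ≤ chord r s φ := by
  refine Real.le_sqrt_of_sq_le ?_
  nlinarith [Real.sin_sq_add_cos_sq φ, sq_nonneg (s * Real.sin φ)]

theorem chord_comm (r s φ : ℝ) : chord r s φ = chord s r φ := by
  unfold chord
  congr 1
  ring

/-- The straight segment between two points of the plane in polar coordinates, along a given
angular motion `θ`. -/
theorem exists_polar_segment {r₀ r₁ Θ : ℝ} (hr₀ : 0 < r₀) (hr₁ : 0 < r₁) (hΘ : 0 < Θ)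
    (hΘ' : Θ < Real.pi) {θ : ℝ → ℝ} (hθ : ContDiff ℝ 1 θ) (hθ' : ∀ t, 0 ≤ deriv θ t)
    (hθ0 : θ 0 = 0) (hθ1 : θ 1 = Θ) :
    ∃ r l l' : ℝ → ℝ, ContDiffOn ℝ 1 r (Icc 0 1) ∧ r 0 = r₀ ∧ r 1 = r₁ ∧ l 0 = 0 ∧
      l 1 = chord r₀ r₁ Θ ∧ ∀ t ∈ Icc (0 : ℝ) 1, DifferentiableAt ℝ r t ∧
        HasDerivAt l (l' t) t ∧ 0 ≤ l' t ∧ deriv r t ^ 2 + r t ^ 2 * deriv θ t ^ 2 = l' t ^ 2 ∧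
        r₀ ≤ r t + l t ∧ r₁ ≤ r t + (chord r₀ r₁ Θ - l t) := by
  set V := chord r₀ r₁ Θ with hV
  set D : ℝ → ℝ := fun t ↦ r₀ * Real.sin (θ t) + r₁ * Real.sin (Θ - θ t) with hD
  have hsΘ : 0 < Real.sin Θ := Real.sin_pos_of_pos_of_lt_pi hΘ hΘ'
  have hmono : Monotone θ := monotone_of_deriv_nonneg (hθ.differentiable one_ne_zero) hθ'
  have hmem : ∀ t ∈ Icc (0 : ℝ) 1, 0 ≤ θ t ∧ θ t ≤ Θ := fun t ht ↦
    ⟨hθ0 ▸ hmono ht.1, hθ1 ▸ hmono ht.2⟩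
  have hs1 : ∀ t ∈ Icc (0 : ℝ) 1, 0 ≤ Real.sin (θ t) := fun t ht ↦
    Real.sin_nonneg_of_nonneg_of_le_pi (hmem t ht).1 ((hmem t ht).2.trans hΘ'.le)
  have hs2 : ∀ t ∈ Icc (0 : ℝ) 1, 0 ≤ Real.sin (Θ - θ t) := fun t ht ↦
    Real.sin_nonneg_of_nonneg_of_le_pi (sub_nonneg.2 (hmem t ht).2)
      (by linarith [(hmem t ht).1])
  have hDpos : ∀ t ∈ Icc (0 : ℝ) 1, 0 < D t := by
    intro t ht
    rcases (hmem t ht).1.eq_or_lt with h | h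
    · simp only [hD]
      rw [← h, sub_zero, Real.sin_zero, mul_zero, zero_add]
      positivity
    · exact add_pos_of_pos_of_nonneg (mul_pos hr₀ (Real.sin_pos_of_pos_of_lt_pi h
        ((hmem t ht).2.trans_lt hΘ'))) (mul_nonneg hr₁.le (hs2 t ht))
  have hdθ (t : ℝ) : HasDerivAt θ (deriv θ t) t := (hθ.differentiable one_ne_zero t).hasDerivAt
  have hdD (t : ℝ) : HasDerivAt D
      ((r₀ * Real.cos (θ t) - r₁ * Real.cos (Θ - θ t)) * deriv θ t) t := by
    have h1 := (hdθ t).sin.const_mul r₀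
    have h2 := ((hdθ t).const_sub Θ).sin.const_mul r₁
    exact (h1.add h2).congr_deriv (by ring)
  have hsinΘ (t : ℝ) : Real.sin Θ = Real.sin (θ t) * Real.cos (Θ - θ t) +
      Real.cos (θ t) * Real.sin (Θ - θ t) := by
    rw [← Real.sin_add, add_sub_cancel]
  have hcosΘ (t : ℝ) : Real.cos Θ = Real.cos (θ t) * Real.cos (Θ - θ t) -
      Real.sin (θ t) * Real.sin (Θ - θ t) := by
    rw [← Real.cos_add, add_sub_cancel]
  have hV2 : V ^ 2 = r₀ ^ 2 + r₁ ^ 2 - 2 * r₀ * r₁ * Real.cos Θ := chord_sq _ _ _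
  have hV0 : 0 ≤ V := chord_nonneg _ _ _
  have hdr (t : ℝ) (ht : t ∈ Icc (0 : ℝ) 1) :
      HasDerivAt (fun t ↦ r₀ * r₁ * Real.sin Θ / D t) (-(r₀ * r₁ * Real.sin Θ *
        ((r₀ * Real.cos (θ t) - r₁ * Real.cos (Θ - θ t)) * deriv θ t)) / D t ^ 2) t := by
    exact ((hasDerivAt_const t (r₀ * r₁ * Real.sin Θ)).div (hdD t) (hDpos t ht).ne').congr_deriv
      (by ring)
  refine ⟨fun t ↦ r₀ * r₁ * Real.sin Θ / D t, fun t ↦ V * (r₀ * Real.sin (θ t) / D t),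
    fun t ↦ V * (r₀ * r₁ * Real.sin Θ * deriv θ t / D t ^ 2), ?_, ?_, ?_, ?_, ?_, ?_⟩
  · refine contDiffOn_const.div (ContDiff.contDiffOn ?_) fun t ht ↦ (hDpos t ht).ne'
    exact (contDiff_const.mul hθ.sin).add (contDiff_const.mul (contDiff_const.sub hθ).sin)
  · simp only [hD]
    rw [hθ0, sub_zero, Real.sin_zero]
    field_simp
    ring
  · simp only [hD]
    rw [hθ1, sub_self, Real.sin_zero]
    field_simp
    ring
  · simp [hθ0]
  · simp only [hD]
    rw [hθ1, sub_self, Real.sin_zero]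
    field_simp
    ring
  intro t ht
  have hDt := hDpos t ht
  have hD' : D t = r₀ * Real.sin (θ t) + r₁ * Real.sin (Θ - θ t) := rfl
  refine ⟨(hdr t ht).differentiableAt, ?_, ?_, ?_, ?_, ?_⟩
  · refine ((((hdθ t).sin.const_mul r₀).div (hdD t) hDt.ne').const_mul V).congr_deriv ?_
    congr 2
    rw [hD', hsinΘ t]
    ring
  · have := hθ' t
    positivity
  · rw [(hdr t ht).deriv]
    have h1 : (r₀ * Real.cos (θ t) - r₁ * Real.cos (Θ - θ t)) ^ 2 + D t ^ 2 = V ^ 2 := by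
      rw [hV2, hcosΘ t, hD']
      linear_combination r₀ ^ 2 * Real.sin_sq_add_cos_sq (θ t) +
        r₁ ^ 2 * Real.sin_sq_add_cos_sq (Θ - θ t)
    rw [mul_pow, ← h1]
    field_simp
  · have h1 : D t ≤ r₁ * Real.sin Θ + V * Real.sin (θ t) := by
      have h2 := mul_le_mul_of_nonneg_right (sub_mul_cos_le_chord r₀ r₁ Θ) (hs1 t ht)
      have h3 := mul_le_mul_of_nonneg_left (Real.cos_le_one (θ t)) (mul_pos hr₁ hsΘ).le
      rw [hD', Real.sin_sub]
      linarith
    simp only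
    rw [mul_div_assoc', ← add_div, le_div_iff₀ hDt]
    calc r₀ * D t ≤ r₀ * (r₁ * Real.sin Θ + V * Real.sin (θ t)) := by gcongr
      _ = _ := by ring
  · have h1 : D t ≤ r₀ * Real.sin Θ + V * Real.sin (Θ - θ t) := by
      have h2 := mul_le_mul_of_nonneg_right (sub_mul_cos_le_chord r₁ r₀ Θ) (hs2 t ht)
      have h3 := mul_le_mul_of_nonneg_left (Real.cos_le_one (Θ - θ t)) (mul_pos hr₀ hsΘ).le
      have h4 : Real.sin (θ t) = Real.sin Θ * Real.cos (Θ - θ t) -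
          Real.cos Θ * Real.sin (Θ - θ t) := by
        rw [← Real.sin_sub, sub_sub_cancel]
      rw [chord_comm] at h2
      rw [hD', h4]
      linarith
    have h5 : V - V * (r₀ * Real.sin (θ t) / D t) = V * (r₁ * Real.sin (Θ - θ t)) / D t := by
      rw [eq_div_iff hDt.ne', sub_mul, mul_assoc V, div_mul_cancel₀ _ hDt.ne', hD']
      ring
    simp only
    rw [h5, ← add_div, le_div_iff₀ hDt]
    calc r₁ * D t ≤ r₁ * (r₀ * Real.sin Θ + V * Real.sin (Θ - θ t)) := by gcongr
      _ = _ := by ring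

end MetricCone

namespace WarpedCone

/-- The ratio of the radii `(1 + ρ²) ^ (a / 2)` and `K = ρ ^ a`. -/
def stretch (a K : ℝ) : ℝ := (1 + K ^ (-2 / a)) ^ (a / 2)

theorem stretch_anti {a : ℝ} (ha : 0 < a) {K r : ℝ} (hK : 0 < K) (hr : K ≤ r) :
    stretch a r ≤ stretch a K := by
  have hr0 := hK.trans_le hr
  unfold stretch
  gcongr ?_ ^ (a / 2)
  gcongr 1 + ?_
  exact Real.rpow_le_rpow_of_nonpos hK hr (div_nonpos_of_nonpos_of_nonneg (by norm_num) ha.le)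

theorem one_le_stretch {a K : ℝ} (ha : 0 < a) (hK : 0 < K) : 1 ≤ stretch a K :=
  Real.one_le_rpow (by have := Real.rpow_pos_of_pos hK (-2 / a); linarith) (by positivity)

theorem mul_stretch {a : ℝ} (ha : 0 < a) {ρ : ℝ} (hρ : 0 < ρ) :
    ρ ^ a * stretch a (ρ ^ a) = (1 + ρ ^ 2) ^ (a / 2) := by
  have h1 : (ρ ^ a) ^ (-2 / a) = (ρ ^ 2)⁻¹ := by
    rw [← Real.rpow_mul hρ.le, mul_div_cancel₀ _ ha.ne', Real.rpow_neg hρ.le]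
    norm_num
  have h2 : ρ ^ a = (ρ ^ 2) ^ (a / 2) := by
    rw [← Real.rpow_natCast ρ 2, ← Real.rpow_mul hρ.le]
    congr 1
    push_cast
    ring
  rw [stretch, h1, h2, ← Real.mul_rpow (by positivity) (by positivity)]
  congr 1
  field_simp
  ring

theorem mul_stretch_sq {a : ℝ} (ha : 0 < a) {ρ : ℝ} (hρ : 0 < ρ) :
    (ρ ^ a * stretch a (ρ ^ a)) ^ 2 = (1 + ρ ^ 2) ^ a := by
  rw [mul_stretch ha hρ, ← Real.rpow_mul_natCast (by positivity : (0 : ℝ) ≤ 1 + ρ ^ 2)]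
  congr 1
  push_cast
  ring

theorem tendsto_stretch {a : ℝ} (ha : 0 < a) :
    Filter.Tendsto (stretch a) Filter.atTop (𝓝 1) := by
  have h1 : Filter.Tendsto (fun K : ℝ ↦ 1 + K ^ (-2 / a)) Filter.atTop (𝓝 (1 + 0)) := by
    have := (tendsto_rpow_neg_atTop (y := 2 / a) (by positivity)).const_add 1
    simpa only [neg_div] using this
  have h2 := h1.rpow_const (p := a / 2) (Or.inl (by norm_num))
  rw [add_zero, Real.one_rpow] at h2
  exact h2

variable {F : Type*} [NormedAddCommGroup F] [InnerProductSpace ℝ F]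

/-- The cap metric in radial directions. -/
theorem capMetric_smul_self (a : ℝ) (y : F) (k : ℝ) :
    capMetric a y (k • y) (k • y) =
      a ^ 2 * (1 + ‖y‖ ^ 2) ^ a / (1 + ‖y‖ ^ 2) * ‖y‖ ^ 2 * k ^ 2 := by
  have h := mul_quot a (‖y‖ ^ 2)
  rw [capMetric_apply, real_inner_self_eq_norm_sq, inner_smul_right, real_inner_self_eq_norm_sq,
    norm_smul, mul_pow, Real.norm_eq_abs, sq_abs]
  linear_combination a ^ 2 / (1 + ‖y‖ ^ 2) * k ^ 2 * ‖y‖ ^ 2 * h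

/-- The cap metric in angular directions. -/
theorem capMetric_of_inner_eq_zero (a : ℝ) {y v : F} (h : inner ℝ y v = 0) :
    capMetric a y v v = a ^ 2 / (1 + ‖y‖ ^ 2) * ‖v‖ ^ 2 := by
  rw [capMetric_apply, h, real_inner_self_eq_norm_sq]
  ring

theorem exists_cos_sin_of_norm_eq_one [FiniteDimensional ℝ F] (hF : 2 ≤ Module.finrank ℝ F)
    {u w : F} (hu : ‖u‖ = 1) (hw : ‖w‖ = 1) :
    ∃ v : F, ‖v‖ = 1 ∧ inner ℝ u v = 0 ∧ ∃ φ : ℝ, 0 ≤ φ ∧ φ ≤ Real.pi ∧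
      w = Real.cos φ • u + Real.sin φ • v := by
  set k := inner ℝ u w with hk
  have huu : inner ℝ u u = (1 : ℝ) := by rw [real_inner_self_eq_norm_sq, hu]; norm_num
  have hww : inner ℝ w w = (1 : ℝ) := by rw [real_inner_self_eq_norm_sq, hw]; norm_num
  have hk1 : |k| ≤ 1 := by simpa [hu, hw] using abs_real_inner_le_norm u w
  set z := w - k • u with hz
  have hzz : ‖z‖ ^ 2 = 1 - k ^ 2 := by
    rw [← real_inner_self_eq_norm_sq, hz, inner_sub_sub_self, inner_smul_left, inner_smul_right,
      inner_smul_left, inner_smul_right, huu, hww, real_inner_comm u w, ← hk]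
    simp
    ring
  have huz : inner ℝ u z = 0 := by
    rw [hz, inner_sub_right, inner_smul_right, huu, ← hk]; ring
  have hcos : Real.cos (Real.arccos k) = k := Real.cos_arccos (abs_le.1 hk1).1 (abs_le.1 hk1).2
  have hsin : Real.sin (Real.arccos k) = ‖z‖ := by
    rw [Real.sin_arccos, ← hzz, Real.sqrt_sq (norm_nonneg _)]
  by_cases hz0 : z = 0
  · obtain ⟨v, hv0, hv⟩ : ∃ v : F, v ≠ 0 ∧ inner ℝ u v = 0 := by
      by_contra! hcon
      have h1 : (ℝ ∙ u)ᗮ = ⊥ := by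
        rw [Submodule.eq_bot_iff]
        intro v hv
        by_contra hv0
        exact hcon v hv0 (Submodule.mem_orthogonal_singleton_iff_inner_right.1 hv)
      have h2 : (ℝ ∙ u) = ⊤ := (Submodule.orthogonal_eq_bot_iff).1 h1
      have h3 := finrank_span_singleton (K := ℝ) (v := u) (by rintro rfl; simp at hu)
      rw [h2, finrank_top] at h3
      omega
    refine ⟨‖v‖⁻¹ • v, by simp [norm_smul, hv0], by rw [inner_smul_right, hv, mul_zero],
      Real.arccos k, Real.arccos_nonneg k, Real.arccos_le_pi k, ?_⟩
    rw [hcos, hsin, hz0, norm_zero, zero_smul, add_zero]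
    exact sub_eq_zero.1 hz0
  · have hzn : ‖z‖ ≠ 0 := norm_ne_zero_iff.2 hz0
    refine ⟨‖z‖⁻¹ • z, by simp [norm_smul, hzn], by rw [inner_smul_right, huz, mul_zero],
      Real.arccos k, Real.arccos_nonneg k, Real.arccos_le_pi k, ?_⟩
    rw [hcos, hsin, smul_smul, mul_inv_cancel₀ hzn, one_smul, hz]
    abel

end WarpedCone

namespace SmoothMetric

open WarpedCone Set MeasureTheory
open scoped Bundle

variable {E : Type*} [NormedAddCommGroup E] [NormedSpace ℝ E] [FiniteDimensional ℝ E]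
  {H : Type*} [TopologicalSpace H] {I : ModelWithCorners ℝ E H} [I.Boundaryless]
  {M : Type*} [TopologicalSpace M] [ChartedSpace H M] [IsManifold I ∞ M]
  {F : Type*} [NormedAddCommGroup F] [InnerProductSpace ℝ F] [FiniteDimensional ℝ F]

theorem dist_warp_le_of_polar {a : ℝ} (ha : 0 < a) (g : SmoothMetric I M) {c : ℝ → M}
    (hc : ContMDiff 𝓘(ℝ, ℝ) I 1 c) {e : F} (he : ‖e‖ = 1) {K : ℝ} (hK : 0 < K) {r l l' : ℝ → ℝ}
    (hr : ContDiffOn ℝ 1 r (Icc 0 1)) (hrK : ∀ t ∈ Icc (0 : ℝ) 1, K ≤ r t)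
    (hrd : ∀ t ∈ Ioo (0 : ℝ) 1, DifferentiableAt ℝ r t) (hl : ContinuousOn l (Icc 0 1))
    (hl' : ∀ t ∈ Ioo (0 : ℝ) 1, HasDerivAt l (l' t) t) (hl0 : ∀ t ∈ Ioo (0 : ℝ) 1, 0 ≤ l' t)
    (hle : ∀ t ∈ Ioo (0 : ℝ) 1, deriv r t ^ 2 + r t ^ 2 * g.speed c t ^ 2 ≤ l' t ^ 2) :
    (warp ha g).dist (c 0, r 0 ^ a⁻¹ • e) (c 1, r 1 ^ a⁻¹ • e) ≤ stretch a K * (l 1 - l 0) := by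
  have hr0 : ∀ t ∈ Icc (0 : ℝ) 1, 0 < r t := fun t ht ↦ hK.trans_le (hrK t ht)
  have hy : ContDiffOn ℝ 1 (fun t ↦ r t ^ a⁻¹ • e) (Icc 0 1) :=
    (hr.rpow_const_of_ne fun t ht ↦ (hr0 t ht).ne').smul contDiffOn_const
  have hS := zero_le_one.trans (one_le_stretch ha hK)
  have hmono : l 0 ≤ l 1 := by
    refine monotoneOn_of_deriv_nonneg (convex_Icc 0 1) hl ?_ ?_ (left_mem_Icc.2 zero_le_one)
      (right_mem_Icc.2 zero_le_one) zero_le_one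
    · rw [interior_Icc]
      exact fun t ht ↦ (hl' t ht).differentiableAt.differentiableWithinAt
    · rw [interior_Icc]
      exact fun t ht ↦ (hl' t ht).deriv.symm ▸ hl0 t ht
  rw [mul_sub]
  refine dist_le_of_speed_le (warp ha g) (c := fun t ↦ (c t, r t ^ a⁻¹ • e))
    (l := fun t ↦ stretch a K * l t) (l' := fun t ↦ stretch a K * l' t)
    (hc.contMDiffOn.prodMk hy.contMDiffOn) (continuousOn_const.mul hl)
    (fun t ht ↦ (hl' t ht).const_mul _) (fun t ht ↦ ?_)
    (mul_le_mul_of_nonneg_left hmono hS)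
  have ht' := Ioo_subset_Icc_self ht
  have hrt := hr0 t ht'
  have hd : HasDerivAt (fun t ↦ r t ^ a⁻¹ • e) ((deriv r t / (a * r t)) • (r t ^ a⁻¹ • e)) t := by
    refine (((hrd t ht).hasDerivAt.rpow_const (p := a⁻¹) (Or.inl hrt.ne')).smul_const e).congr_deriv
      ?_
    rw [smul_smul, Real.rpow_sub_one hrt.ne']
    congr 1
    field_simp
  refine abs_le_of_sq_le_sq' ?_ (mul_nonneg hS (hl0 t ht)) |>.2
  rw [speed_warp_sq ha g ((hc t).mdifferentiableAt one_ne_zero) hd.differentiableAt, hd.deriv,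
    capMetric_smul_self]
  have hρ : ‖r t ^ a⁻¹ • e‖ = r t ^ a⁻¹ := by
    rw [norm_smul, he, mul_one, Real.norm_of_nonneg (by positivity)]
  rw [hρ]
  set ρ := r t ^ a⁻¹ with hρdef
  have hρ0 : 0 < ρ := Real.rpow_pos_of_pos hrt _
  have hρa : ρ ^ a = r t := by
    rw [hρdef, ← Real.rpow_mul hrt.le, inv_mul_cancel₀ ha.ne', Real.rpow_one]
  have hX : (1 + ρ ^ 2) ^ a = (stretch a (r t) * r t) ^ 2 := by
    rw [← mul_stretch_sq ha hρ0, hρa, mul_comm]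
  have h1 : a ^ 2 * (1 + ρ ^ 2) ^ a / (1 + ρ ^ 2) * ρ ^ 2 * (deriv r t / (a * r t)) ^ 2 ≤
      stretch a (r t) ^ 2 * deriv r t ^ 2 := by
    rw [hX]
    have h2 : ρ ^ 2 / (1 + ρ ^ 2) ≤ 1 := by
      rw [div_le_one (by positivity)]; linarith
    calc _ = stretch a (r t) ^ 2 * deriv r t ^ 2 * (ρ ^ 2 / (1 + ρ ^ 2)) := by field_simp
      _ ≤ _ := mul_le_of_le_one_right (by positivity) h2
  calc _ ≤ (stretch a (r t) * r t) ^ 2 * g.speed c t ^ 2 + stretch a (r t) ^ 2 * deriv r t ^ 2 := by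
        rw [← hX]; gcongr
    _ = stretch a (r t) ^ 2 * (deriv r t ^ 2 + r t ^ 2 * g.speed c t ^ 2) := by ring
    _ ≤ stretch a K ^ 2 * l' t ^ 2 := by
        gcongr
        · exact zero_le_one.trans (one_le_stretch ha hrt)
        · exact stretch_anti ha hK (hrK t ht')
        · exact hle t ht
    _ = _ := by ring

theorem dist_warp_radial_le {a : ℝ} (ha : 0 < a) (g : SmoothMetric I M) (x : M) {e : F}
    (he : ‖e‖ = 1) {K r : ℝ} (hK : 0 < K) (hr : K ≤ r) :
    (warp ha g).dist (x, K ^ a⁻¹ • e) (x, r ^ a⁻¹ • e) ≤ stretch a K * (r - K) := by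
  have hd (t : ℝ) : HasDerivAt (fun t : ℝ ↦ K + t * (r - K)) (r - K) t := by
    simpa using ((hasDerivAt_id t).mul_const (r - K)).const_add K
  have hsp (t : ℝ) : g.speed (fun _ ↦ x) t = 0 := by
    have : velocity I (fun _ : ℝ ↦ x) t = 0 := by
      rw [velocity, mfderiv_const]; rfl
    rw [speed, this]; simp
  have := dist_warp_le_of_polar ha g (c := fun _ ↦ x) contMDiff_const he hK
    (r := fun t ↦ K + t * (r - K)) (l := fun t ↦ K + t * (r - K)) (l' := fun _ ↦ r - K)
    (by fun_prop) (fun t ht ↦ by nlinarith [ht.1]) (fun t _ ↦ (hd t).differentiableAt)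
    (fun t _ ↦ (hd t).continuousAt.continuousWithinAt) (fun t _ ↦ hd t)
    (fun _ _ ↦ sub_nonneg.2 hr) (fun t _ ↦ by rw [(hd t).deriv, hsp]; simp)
  simpa using this

theorem dist_warp_rotate_le {a : ℝ} (ha : 0 < a) (g : SmoothMetric I M)
    (hF : 2 ≤ Module.finrank ℝ F) (x : M) {e e' : F} (he : ‖e‖ = 1) (he' : ‖e'‖ = 1) (ρ : ℝ) :
    (warp ha g).dist (x, ρ • e) (x, ρ • e') ≤ a * Real.pi := by
  obtain ⟨v, hv, hev, φ, hφ0, hφ, rfl⟩ := exists_cos_sin_of_norm_eq_one hF he he'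
  set y : ℝ → F := fun t ↦ ρ • (Real.cos (t * φ) • e + Real.sin (t * φ) • v)
  set y' : ℝ → F := fun t ↦ (ρ * φ) • (Real.cos (t * φ) • v - Real.sin (t * φ) • e)
  have hlin (t : ℝ) : HasDerivAt (fun t : ℝ ↦ t * φ) φ t := by
    simpa using (hasDerivAt_id t).mul_const φ
  have hy (t : ℝ) : HasDerivAt y (y' t) t := by
    refine ((((hlin t).cos.smul_const e).add ((hlin t).sin.smul_const v)).const_smul ρ).congr_deriv ?_
    simp only [y']
    module
  have hve : inner ℝ v e = 0 := by rw [real_inner_comm, hev]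
  have hee : inner ℝ e e = (1 : ℝ) := by rw [real_inner_self_eq_norm_sq, he]; norm_num
  have hvv : inner ℝ v v = (1 : ℝ) := by rw [real_inner_self_eq_norm_sq, hv]; norm_num
  have hyy' (t : ℝ) : inner ℝ (y t) (y' t) = 0 := by
    simp only [y, y', inner_smul_left, inner_smul_right, inner_add_left, inner_sub_right, hev, hve,
      hee, hvv, conj_trivial]
    ring
  have hny (t : ℝ) : ‖y t‖ ^ 2 = ρ ^ 2 := by
    rw [← real_inner_self_eq_norm_sq]
    simp only [y, inner_smul_left, inner_smul_right, inner_add_left, inner_add_right, hev, hve,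
      hee, hvv, conj_trivial]
    linear_combination ρ ^ 2 * Real.sin_sq_add_cos_sq (t * φ)
  have hny' (t : ℝ) : ‖y' t‖ ^ 2 = ρ ^ 2 * φ ^ 2 := by
    rw [← real_inner_self_eq_norm_sq]
    simp only [y', inner_smul_left, inner_smul_right, inner_sub_left, inner_sub_right, hev, hve,
      hee, hvv, conj_trivial]
    linear_combination ρ ^ 2 * φ ^ 2 * Real.sin_sq_add_cos_sq (t * φ)
  have hyc : ContDiff ℝ 1 y := by
    have h1 : ContDiff ℝ 1 fun t : ℝ ↦ t * φ := by fun_prop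
    exact contDiff_const.smul ((h1.cos.smul contDiff_const).add (h1.sin.smul contDiff_const))
  have hsp (t : ℝ) : g.speed (fun _ ↦ x) t = 0 := by
    have : velocity I (fun _ : ℝ ↦ x) t = 0 := by
      rw [velocity, mfderiv_const]; rfl
    rw [speed, this]; simp
  have hl (t : ℝ) : HasDerivAt (fun t : ℝ ↦ t * (a * φ)) (a * φ) t := by
    simpa using (hasDerivAt_id t).mul_const (a * φ)
  have h := dist_le_of_speed_le (warp ha g) (c := fun t ↦ (x, y t))
    (l := fun t ↦ t * (a * φ)) (l' := fun t ↦ a * φ)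
    (contMDiff_const.contMDiffOn.prodMk hyc.contMDiff.contMDiffOn)
    (fun t _ ↦ (hl t).continuousAt.continuousWithinAt) (fun t _ ↦ hl t)
    (fun t _ ↦ by
      refine abs_le_of_sq_le_sq' ?_ (by positivity) |>.2
      rw [speed_warp_sq ha g mdifferentiableAt_const (hy t).differentiableAt, hsp, (hy t).deriv,
        capMetric_of_inner_eq_zero a (hyy' t), hny, hny']
      have : ρ ^ 2 / (1 + ρ ^ 2) ≤ 1 := by
        rw [div_le_one (by positivity)]; linarith
      calc _ = a ^ 2 * φ ^ 2 * (ρ ^ 2 / (1 + ρ ^ 2)) := by ring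
        _ ≤ a ^ 2 * φ ^ 2 := mul_le_of_le_one_right (by positivity) this
        _ = (a * φ) ^ 2 := by ring)
    (by simp only [zero_mul, one_mul]; positivity)
  simp only [y, zero_mul, one_mul, Real.cos_zero, Real.sin_zero, one_smul, zero_smul, add_zero,
    sub_zero] at h
  exact h.trans (by gcongr)

/-- The distance between points far out in the same radial direction. -/
theorem exists_dist_warp_le [ConnectedSpace M] [CompactSpace M] {a : ℝ} (ha : 0 < a)
    (g : SmoothMetric I M) {e : F} (he : ‖e‖ = 1) {K : ℝ} (hK : 0 < K) :
    ∃ C, ∀ x y : M, ∀ r s : ℝ, K ≤ r → K ≤ s →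
      (warp ha g).dist (x, r ^ a⁻¹ • e) (y, s ^ a⁻¹ • e) ≤
        stretch a K * MetricCone.chord r s (min (g.dist x y) Real.pi) + C := by
  obtain ⟨C, hC⟩ := exists_dist_le_of_isCompact (warp ha g)
    (isCompact_univ.prod (isCompact_singleton (x := K ^ a⁻¹ • e)))
  have hS := zero_le_one.trans (one_le_stretch ha hK)
  refine ⟨C, fun x y r s hr hs ↦ ?_⟩
  have hr0 := hK.trans_le hr
  have hs0 := hK.trans_le hs
  have hC0 : 0 ≤ C := (dist_nonneg _ _ _).trans (hC (x, K ^ a⁻¹ • e) (by simp) (x, K ^ a⁻¹ • e)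
    (by simp))
  have hcore : (warp ha g).dist (x, r ^ a⁻¹ • e) (y, s ^ a⁻¹ • e) ≤
      stretch a K * (r + s - 2 * K) + C := by
    have h1 := dist_warp_radial_le ha g x he hK hr
    have h2 := dist_warp_radial_le ha g y he hK hs
    have h3 := hC (x, K ^ a⁻¹ • e) (by simp) (y, K ^ a⁻¹ • e) (by simp)
    have h4 := dist_triangle (warp ha g) (x, r ^ a⁻¹ • e) (x, K ^ a⁻¹ • e) (y, s ^ a⁻¹ • e)
    have h5 := dist_triangle (warp ha g) (x, K ^ a⁻¹ • e) (y, K ^ a⁻¹ • e) (y, s ^ a⁻¹ • e)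
    rw [dist_comm] at h1
    linarith
  rcases le_or_gt Real.pi (g.dist x y) with hd | hd
  · rw [min_eq_right hd, MetricCone.chord_pi hr0.le hs0.le]
    refine hcore.trans ?_
    gcongr
    linarith
  rw [min_eq_left hd.le]
  have key : ∀ Θ ∈ Ioo (g.dist x y) Real.pi,
      (warp ha g).dist (x, r ^ a⁻¹ • e) (y, s ^ a⁻¹ • e) ≤
        stretch a K * MetricCone.chord r s Θ + C := by
    intro Θ hΘ
    have hΘ0 : 0 < Θ := (dist_nonneg g x y).trans_lt hΘ.1
    obtain ⟨c, hc, rfl, rfl, hlt⟩ := exists_curve_of_dist_lt g hΘ.1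
    have hcont := continuous_speed g hc
    set η := Θ - ∫ t in 0..1, g.speed c t
    set θ : ℝ → ℝ := fun t ↦ η * t + ∫ s in 0..t, g.speed c s with hθdef
    have hη : 0 < η := sub_pos.2 hlt
    have hd (t : ℝ) : HasDerivAt θ (η + g.speed c t) t := by
      have h1 : HasDerivAt (fun t ↦ ∫ s in 0..t, g.speed c s) (g.speed c t) t :=
        intervalIntegral.integral_hasDerivAt_right (hcont.intervalIntegrable _ _)
          (hcont.stronglyMeasurableAtFilter _ _) hcont.continuousAt
      exact (((hasDerivAt_id t).const_mul η).add h1).congr_deriv (by rw [mul_one])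
    have hderiv : deriv θ = fun t ↦ η + g.speed c t := funext fun t ↦ (hd t).deriv
    have hθ : ContDiff ℝ 1 θ := by
      rw [contDiff_one_iff_deriv, hderiv]
      exact ⟨fun t ↦ (hd t).differentiableAt, continuous_const.add hcont⟩
    obtain ⟨ρ, l, l', hρ, hρ0, hρ1, hl0, hl1, h⟩ := MetricCone.exists_polar_segment hr0 hs0 hΘ0 hΘ.2
      hθ (fun t ↦ by rw [hderiv]; exact add_nonneg hη.le (speed_nonneg g c t))
      (by simp [hθdef]) (by simp [hθdef, η])
    by_cases hall : ∀ t ∈ Icc (0 : ℝ) 1, K ≤ ρ t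
    · have := dist_warp_le_of_polar ha g hc he hK hρ hall
        (fun t ht ↦ (h t (Ioo_subset_Icc_self ht)).1)
        (fun t ht ↦ (h t ht).2.1.continuousAt.continuousWithinAt)
        (fun t ht ↦ (h t (Ioo_subset_Icc_self ht)).2.1)
        (fun t ht ↦ (h t (Ioo_subset_Icc_self ht)).2.2.1)
        (fun t ht ↦ by
          rw [← (h t (Ioo_subset_Icc_self ht)).2.2.2.1, hderiv]
          have := speed_nonneg g c t
          gcongr
          linarith)
      rw [hρ0, hρ1, hl0, hl1, sub_zero] at this
      exact this.trans (le_add_of_nonneg_right hC0)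
    · push Not at hall
      obtain ⟨t, ht, htK⟩ := hall
      obtain ⟨-, -, -, -, h1, h2⟩ := h t ht
      refine hcore.trans ?_
      gcongr
      linarith
  have hlim : Filter.Tendsto (fun Θ ↦ stretch a K * MetricCone.chord r s Θ + C)
      (𝓝[>] (g.dist x y)) (𝓝 (stretch a K * MetricCone.chord r s (g.dist x y) + C)) :=
    ((continuous_const.mul (MetricCone.continuous_chord r s)).add_const C).continuousAt.tendsto.mono_left
      nhdsWithin_le_nhds
  exact ge_of_tendsto hlim (Filter.mem_of_superset (Ioo_mem_nhdsGT hd) key)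

end SmoothMetric


namespace MetricCone

open Set
open scoped NNReal

theorem dist_mk {X : Type*} (d : X → X → ℝ) (r s : ℝ≥0) (x y : X) :
    dist d (mk r x) (mk s y) = chord r s (min (d x y) Real.pi) := rfl

theorem mk_zero_eq_apex {X : Type*} [Nonempty X] (x : X) : mk 0 x = apex X :=
  Quotient.sound (s := setoid X) (Or.inr ⟨rfl, rfl⟩)

theorem dist_apex_mk {X : Type*} [Nonempty X] (d : X → X → ℝ) (s : ℝ≥0) (x : X) :
    dist d (apex X) (mk s x) = s := by
  rw [← mk_zero_eq_apex x, dist_mk, chord]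
  simp

theorem chord_self_zero (r : ℝ) : chord r r 0 = 0 := by
  rw [chord, Real.cos_zero, Real.sqrt_eq_zero']
  linarith

/-- If a space with coordinates in a cone has a distance that differs from the cone distance by
sublinear terms, then the cone is its asymptotic cone. -/
theorem hasAsymptoticCone_of_abs_sub_le {N X : Type*} [Nonempty X] {dN : N → N → ℝ}
    {dX : X → X → ℝ} (hdX : ∀ x, dX x x = 0) (ρ : N → ℝ≥0) (π : N → X)
    (hsurj : ∀ (r : ℝ≥0) (x : X), ∃ a, ρ a = r ∧ π a = x)
    (happ : ∀ ε > 0, ∃ C, ∀ a b,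
      |chord (ρ a) (ρ b) (min (dX (π a) (π b)) Real.pi) - dN a b| ≤ ε * (ρ a + ρ b) + C) :
    HasAsymptoticCone dN (dist dX) (apex X) := by
  classical
  intro p r hr ε hε
  obtain ⟨ε₁, hε₁, hε₁', hε₁r⟩ : ∃ ε₁ : ℝ, 0 < ε₁ ∧ ε₁ ≤ 1 / 2 ∧ ε₁ * (2 * r + 1) ≤ ε / 8 := by
    refine ⟨min (1 / 2) (ε / 8 / (2 * r + 1)), lt_min (by norm_num) (by positivity),
      min_le_left _ _, ?_⟩
    calc min (1 / 2) (ε / 8 / (2 * r + 1)) * (2 * r + 1)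
        ≤ ε / 8 / (2 * r + 1) * (2 * r + 1) := by gcongr; exact min_le_right _ _
      _ = ε / 8 := by field_simp
  obtain ⟨C₀, hC₀⟩ := happ ε₁ hε₁
  obtain ⟨C, hC0, hC⟩ : ∃ C, 0 ≤ C ∧ ∀ a b,
      |chord (ρ a) (ρ b) (min (dX (π a) (π b)) Real.pi) - dN a b| ≤ ε₁ * (ρ a + ρ b) + C :=
    ⟨max C₀ 0, le_max_right _ _, fun a b ↦ (hC₀ a b).trans (by gcongr; exact le_max_left _ _)⟩
  set c : ℝ := 2 * ρ p + C with hc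
  have hc0 : 0 ≤ c := by positivity
  set η : ℝ := min (ε / 4) (1 / 2)
  have hη : 0 < η := lt_min (by positivity) (by norm_num)
  filter_upwards [Ioo_mem_nhdsGT (show 0 < η / (c + 1) by positivity)] with R hR
  have hR0 : 0 < R := hR.1
  have hRc : R * c < η := by
    have := (lt_div_iff₀ (by positivity)).1 hR.2
    nlinarith
  have hRc1 : R * c < ε / 4 := hRc.trans_le (min_le_left _ _)
  have hRc2 : R * c < 1 / 2 := hRc.trans_le (min_le_right _ _)
  have hRρ : 0 ≤ R * ρ p := by positivity
  have hRC : 0 ≤ R * C := by positivity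
  have hRc' : R * c = 2 * (R * ρ p) + R * C := by rw [hc]; ring
  set s : N → ℝ≥0 := fun a ↦ if a = p then 0 else R.toNNReal * ρ a with hs
  have hsa (a : N) : |(s a : ℝ) - R * ρ a| ≤ R * ρ p := by
    simp only [hs]
    split_ifs with h
    · rw [h, NNReal.coe_zero, zero_sub, abs_neg, abs_of_nonneg hRρ]
    · rw [NNReal.coe_mul, Real.coe_toNNReal _ hR0.le, sub_self, abs_zero]
      exact hRρ
  have hscale (a b : N) : |chord (R * ρ a) (R * ρ b) (min (dX (π a) (π b)) Real.pi) - R * dN a b| ≤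
      ε₁ * (R * ρ a + R * ρ b) + R * C := by
    rw [chord_mul hR0.le, ← mul_sub, abs_mul, abs_of_pos hR0]
    calc _ ≤ R * (ε₁ * (ρ a + ρ b) + C) := by gcongr; exact hC a b
      _ = _ := by ring
  refine ⟨fun a ↦ mk (s a) (π a), ?_, ⟨ε / 2 + ε / 4, by linarith, fun a b ha hb ↦ ?_⟩, ?_⟩
  · simp only [hs, if_true]
    exact mk_zero_eq_apex _
  · have hball (a : N) (ha : R * dN p a < r) : R * ρ a ≤ 2 * r + 1 := by
      have h1 := (abs_le.1 (hscale p a)).2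
      have h2 := (neg_le_abs _).trans
        (abs_sub_le_chord hRρ (by positivity : 0 ≤ R * (ρ a : ℝ)) (min (dX (π p) (π a)) Real.pi))
      have h3 : ε₁ * (R * ρ p + R * ρ a) ≤ 1 / 2 * (R * ρ p + R * ρ a) := by gcongr
      linarith
    have h1 := hscale a b
    have h2 := abs_chord_sub_chord_le (s a) (s b) (R * ρ a) (R * ρ b)
      (min (dX (π a) (π b)) Real.pi)
    have h3 : ε₁ * (R * ρ a + R * ρ b) ≤ ε₁ * ((2 * r + 1) + (2 * r + 1)) := by
      gcongr
      · exact hball a ha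
      · exact hball b hb
    have h4 := abs_sub_le (chord (s a) (s b) (min (dX (π a) (π b)) Real.pi))
      (chord (R * ρ a) (R * ρ b) (min (dX (π a) (π b)) Real.pi)) (R * dN a b)
    rw [dist_mk]
    linarith [hsa a, hsa b]
  · intro y
    refine Quotient.inductionOn (s := setoid X) y fun ⟨t, x⟩ ↦ ?_
    change dist dX (apex X) (mk t x) < r - ε → ∃ a, R * dN p a < r ∧ dist dX (mk t x) _ < ε
    rw [dist_apex_mk]
    intro ht
    obtain ⟨a, ha, hax⟩ := hsurj (t / R.toNNReal) x
    have hta : R * ρ a = t := by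
      rw [ha, NNReal.coe_div, Real.coe_toNNReal _ hR0.le, mul_div_cancel₀ _ hR0.ne']
    have ht0 : (0 : ℝ) ≤ t := t.2
    refine ⟨a, ?_, ?_⟩
    · have h1 := (abs_le.1 (hscale p a)).1
      have h2 := chord_le_add hRρ ht0 (min (dX (π p) (π a)) Real.pi)
      rw [hta] at h1
      have h3 : ε₁ * (R * ρ p + t) ≤ 1 / 2 * (R * ρ p) + ε₁ * (2 * r + 1) := by
        rw [mul_add]
        gcongr
        linarith
      linarith
    · rw [dist_mk, hax, hdX, min_eq_left Real.pi_pos.le]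
      have h1 := abs_chord_sub_chord_le t (s a) t t 0
      rw [chord_self_zero, sub_self, abs_zero, zero_add, sub_zero] at h1
      have h2 := hsa a
      rw [hta] at h2
      linarith [le_abs_self (chord t (s a) 0)]

end MetricCone

namespace WarpedCone

variable {F : Type*} [NormedAddCommGroup F]

theorem rpow_norm_le_radius {a : ℝ} (ha : 0 < a) (y : F) :
    ‖y‖ ^ a ≤ (1 + ‖y‖ ^ 2) ^ (a / 2) := by
  have h : ‖y‖ ^ a = (‖y‖ ^ 2) ^ (a / 2) := by
    rw [← Real.rpow_natCast ‖y‖ 2, ← Real.rpow_mul (norm_nonneg y)]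
    congr 1
    push_cast
    ring
  rw [h]
  gcongr
  linarith

theorem radius_le {a : ℝ} (ha : 0 < a) {K : ℝ} (hK : 0 < K) (y : F) :
    (1 + ‖y‖ ^ 2) ^ (a / 2) ≤ stretch a K * ‖y‖ ^ a + stretch a K * K := by
  have hS := zero_le_one.trans (one_le_stretch ha hK)
  have hy : 0 ≤ ‖y‖ ^ a := by positivity
  rcases le_or_gt K (‖y‖ ^ a) with h | h
  · have hy0 : 0 < ‖y‖ := by
      refine (norm_nonneg y).lt_of_ne fun h0 ↦ ?_
      rw [← h0, Real.zero_rpow ha.ne'] at h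
      exact h.not_gt hK
    rw [← mul_stretch ha hy0]
    have := mul_le_mul_of_nonneg_left (stretch_anti ha hK h) hy
    have := mul_nonneg hS hK.le
    linarith
  · have hρ : 0 < K ^ a⁻¹ := Real.rpow_pos_of_pos hK _
    have hρa : (K ^ a⁻¹) ^ a = K := by
      rw [← Real.rpow_mul hK.le, inv_mul_cancel₀ ha.ne', Real.rpow_one]
    have h1 : ‖y‖ ≤ K ^ a⁻¹ := by
      rw [← hρa] at h
      exact ((Real.rpow_lt_rpow_iff (norm_nonneg y) hρ.le ha).1 h).le
    have h2 := mul_stretch ha hρ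
    rw [hρa] at h2
    calc (1 + ‖y‖ ^ 2) ^ (a / 2) ≤ (1 + (K ^ a⁻¹) ^ 2) ^ (a / 2) := by gcongr
      _ = stretch a K * K := by rw [← h2, mul_comm]
      _ ≤ _ := le_add_of_nonneg_left (mul_nonneg hS hy)

end WarpedCone

namespace SmoothMetric

open WarpedCone Set

variable {E : Type*} [NormedAddCommGroup E] [NormedSpace ℝ E] [FiniteDimensional ℝ E]
  {H : Type*} [TopologicalSpace H] {I : ModelWithCorners ℝ E H} [I.Boundaryless]
  {M : Type*} [TopologicalSpace M] [ChartedSpace H M] [IsManifold I ∞ M]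
  [ConnectedSpace M] [CompactSpace M]
  {F : Type*} [NormedAddCommGroup F] [InnerProductSpace ℝ F] [FiniteDimensional ℝ F]

theorem exists_dist_warp_polar_le {a : ℝ} (ha : 0 < a) (g : SmoothMetric I M)
    (hF : 2 ≤ Module.finrank ℝ F) {e : F} (he : ‖e‖ = 1) {K : ℝ} (hK : 0 < K) :
    ∃ C, ∀ p : M × F,
      (warp ha g).dist p (p.1, (max (‖p.2‖ ^ a) K) ^ a⁻¹ • e) ≤ C := by
  obtain ⟨C, hC⟩ := exists_dist_le_of_isCompact (warp (F := F) ha g)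
    (isCompact_univ.prod (isCompact_closedBall (0 : F) (K ^ a⁻¹)))
  have hρ : 0 < K ^ a⁻¹ := Real.rpow_pos_of_pos hK _
  refine ⟨max C (a * Real.pi), fun ⟨x, y⟩ ↦ ?_⟩
  simp only
  rcases le_or_gt K (‖y‖ ^ a) with h | h
  · refine le_max_of_le_right ?_
    have hy0 : ‖y‖ ≠ 0 := by
      intro h0
      rw [h0, Real.zero_rpow ha.ne'] at h
      exact h.not_gt hK
    rw [max_eq_left h, ← Real.rpow_mul (norm_nonneg y), mul_inv_cancel₀ ha.ne', Real.rpow_one]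
    have h1 : ‖‖y‖⁻¹ • y‖ = 1 := by rw [norm_smul, norm_inv, norm_norm, inv_mul_cancel₀ hy0]
    have h2 := dist_warp_rotate_le ha g hF x h1 he ‖y‖
    rwa [smul_smul, mul_inv_cancel₀ hy0, one_smul] at h2
  · refine le_max_of_le_left (hC _ ⟨trivial, ?_⟩ _ ⟨trivial, ?_⟩)
    · rw [mem_closedBall_zero_iff]
      have hρa : (K ^ a⁻¹) ^ a = K := by
        rw [← Real.rpow_mul hK.le, inv_mul_cancel₀ ha.ne', Real.rpow_one]
      rw [← hρa] at h
      exact ((Real.rpow_lt_rpow_iff (norm_nonneg y) hρ.le ha).1 h).le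
    · rw [max_eq_right h.le, mem_closedBall_zero_iff, norm_smul, he, mul_one,
        Real.norm_of_nonneg hρ.le]

theorem exists_abs_chord_sub_dist_warp_le {a : ℝ} (ha : 0 < a) (g : SmoothMetric I M)
    (hF : 2 ≤ Module.finrank ℝ F) {ε : ℝ} (hε : 0 < ε) :
    ∃ C, ∀ p q : M × F,
      |MetricCone.chord (‖p.2‖ ^ a) (‖q.2‖ ^ a) (min (g.dist p.1 q.1) Real.pi) -
        (warp ha g).dist p q| ≤ ε * (‖p.2‖ ^ a + ‖q.2‖ ^ a) + C := by
  obtain ⟨K, hK1, hK⟩ : ∃ K, stretch a K < 1 + ε ∧ 0 < K :=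
    (((tendsto_stretch ha).eventually_lt_const (by linarith : 1 < 1 + ε)).and
      (Filter.eventually_gt_atTop 0)).exists
  have : Nontrivial F := Module.nontrivial_of_finrank_pos (R := ℝ) (by omega)
  obtain ⟨e, he⟩ := exists_norm_eq F zero_le_one
  obtain ⟨C₁, hC₁⟩ := exists_dist_warp_polar_le ha g hF he hK
  obtain ⟨C₂, hC₂⟩ := exists_dist_warp_le ha g he hK
  have hS := zero_le_one.trans (one_le_stretch ha hK)
  refine ⟨max (2 * (stretch a K * K)) (2 * (stretch a K * K) + C₂ + 2 * C₁), fun p q ↦ ?_⟩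
  have hp0 : 0 ≤ ‖p.2‖ ^ a := by positivity
  have hq0 : 0 ≤ ‖q.2‖ ^ a := by positivity
  set r := ‖p.2‖ ^ a
  set s := ‖q.2‖ ^ a
  set φ := min (g.dist p.1 q.1) Real.pi
  rw [abs_le]
  constructor
  · have h1 := hC₁ p
    have h2 := hC₁ q
    rw [dist_comm] at h2
    have h3 := hC₂ p.1 q.1 (max r K) (max s K) (le_max_right _ _) (le_max_right _ _)
    have h4 := dist_triangle (warp ha g) p (p.1, (max r K) ^ a⁻¹ • e) q
    have h5 := dist_triangle (warp ha g) (p.1, (max r K) ^ a⁻¹ • e) (q.1, (max s K) ^ a⁻¹ • e) q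
    have h6 := (abs_le.1 (MetricCone.abs_chord_sub_chord_le (max r K) (max s K) r s φ)).2
    have hmax : ∀ t : ℝ, 0 ≤ t → |max t K - t| ≤ K := by
      intro t ht
      rw [abs_of_nonneg (sub_nonneg.2 (le_max_left _ _)), sub_le_iff_le_add]
      exact max_le (by linarith) (by linarith)
    have h7 : MetricCone.chord (max r K) (max s K) φ ≤ MetricCone.chord r s φ + 2 * K := by
      linarith [hmax r hp0, hmax s hq0]
    have h8 := mul_le_mul_of_nonneg_left h7 hS
    have h9 : (stretch a K - 1) * MetricCone.chord r s φ ≤ ε * (r + s) :=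
      mul_le_mul (by linarith) (MetricCone.chord_le_add hp0 hq0 φ) (MetricCone.chord_nonneg _ _ _)
        hε.le
    have h10 := le_max_right (2 * (stretch a K * K)) (2 * (stretch a K * K) + C₂ + 2 * C₁)
    linarith
  · have h1 := chord_le_dist_warp ha g p q
    have h2 := (abs_le.1 (MetricCone.abs_chord_sub_chord_le ((1 + ‖p.2‖ ^ 2) ^ (a / 2))
      ((1 + ‖q.2‖ ^ 2) ^ (a / 2)) r s φ)).1
    rw [abs_of_nonneg (sub_nonneg.2 (rpow_norm_le_radius ha p.2)),
      abs_of_nonneg (sub_nonneg.2 (rpow_norm_le_radius ha q.2))] at h2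
    have h3 := radius_le ha hK p.2
    have h4 := radius_le ha hK q.2
    have h5 : stretch a K * (r + s) ≤ (1 + ε) * (r + s) := by gcongr
    have h6 := le_max_left (2 * (stretch a K * K)) (2 * (stretch a K * K) + C₂ + 2 * C₁)
    linarith

theorem hasAsymptoticCone_warp {a : ℝ} (ha : 0 < a) (g : SmoothMetric I M)
    (hF : 2 ≤ Module.finrank ℝ F) :
    HasAsymptoticCone (warp (F := F) ha g).dist (MetricCone.dist g.dist) (MetricCone.apex M) := by
  have : Nontrivial F := Module.nontrivial_of_finrank_pos (R := ℝ) (by omega)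
  obtain ⟨e, he⟩ := exists_norm_eq F zero_le_one
  refine MetricCone.hasAsymptoticCone_of_abs_sub_le (dist_self g)
    (fun p : M × F ↦ ⟨‖p.2‖ ^ a, by positivity⟩) Prod.fst (fun r x ↦ ?_)
    fun ε hε ↦ exists_abs_chord_sub_dist_warp_le ha g hF hε
  refine ⟨(x, (r : ℝ) ^ a⁻¹ • e), NNReal.eq ?_, rfl⟩
  change ‖(r : ℝ) ^ a⁻¹ • e‖ ^ a = r
  rw [norm_smul, he, mul_one, Real.norm_of_nonneg (Real.rpow_nonneg r.coe_nonneg _),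
    ← Real.rpow_mul r.coe_nonneg,
    inv_mul_cancel₀ ha.ne', Real.rpow_one]

end SmoothMetric

end

theorem theoremT {n m : ℕ} (hn : 2 ≤ n) (hm : 2 ≤ m)
    {M : Type*} [TopologicalSpace M] [ChartedSpace (EuclideanSpace ℝ (Fin n)) M]
    [IsManifold (𝓡 n) ∞ M] [T2Space M] [CompactSpace M] [ConnectedSpace M]
    (g : SmoothMetric (𝓡 n) M) (hg : g.RicciGE ((n : ℝ) - 1)) :
    ∃ G : SmoothMetric ((𝓡 n).prod (𝓡 m)) (M × EuclideanSpace ℝ (Fin m)),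
      G.IsComplete ∧ G.RicciGE 0 ∧
        HasAsymptoticCone G.dist (MetricCone.dist g.dist) (MetricCone.apex M) := by
  have hn' : (0 : ℝ) < (n : ℝ) - 1 := by
    have : (2 : ℝ) ≤ n := by exact_mod_cast hn
    linarith
  have hm' : (0 : ℝ) < m := by exact_mod_cast (by omega : 0 < m)
  have ha : 0 < (m : ℝ) / ((n : ℝ) - 1) := div_pos hm' hn'
  refine ⟨SmoothMetric.warp ha g, SmoothMetric.isComplete_warp ha g,
    SmoothMetric.ricciGE_warp ha ?_ ?_ ?_, SmoothMetric.hasAsymptoticCone_warp ha g ?_⟩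
  · rw [finrank_euclideanSpace_fin, finrank_euclideanSpace_fin, div_mul_cancel₀ _ hn'.ne']
  · rwa [finrank_euclideanSpace_fin]
  · rwa [finrank_euclideanSpace_fin]
  · rwa [finrank_euclideanSpace_fin]
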